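/- **Setting.** Let $\mathbf F$ (fluents) and $\mathbf A$ (actions) be finite sets. Literals are $f$ and $\neg f$ for $f\in\mathbf F$; $\neg l$ is the complement of a literal $l$ and $\neg\sigma=\{\neg l\mid l\in\sigma\}$; a set of literals is consistent if it contains no two complementary literals. A domain description $D$ is a set of propositions $\mathbf{executable}(a,\psi)$, $\mathbf{causes}(a,l,\phi)$, $\mathbf{if}(l,\varphi)$, $\mathbf{determines}(a,\theta)$, with $a$ an action, $l$ a literal and $\psi,\phi,\varphi,\theta$ sets of literals. An action is sensing if it occurs in some $\mathbf{determines}(a,\theta)$, and non-sensing otherwise. It is assumed that: every $\varphi$ is non-empty; every $\theta$ has at least two elements; either $\theta=\{f,\neg f\}$ for a fluent $f$, or $D$ contains $\mathbf{if}(\neg g',\{g\})$ for all $g\neq g'$ in $\theta$ and $\mathbf{if}(g,\{\neg g'\mid g'\in\theta\setminus\{g\}\})$ for all $g\in\theta$; no sensing action occurs in a proposition $\mathbf{causes}$; each sensing action occurs in only one proposition $\mathbf{determines}$. A planning problem instance $P=(D,I,G)$ consists of $D$, a set $I$ of propositions $\mathbf{initially}(l)$ and a non-empty set (conjunction) $G$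 of literals; $\delta\models G$ means $G\subseteq\delta$. **Semantics.** $Cl_D(\sigma)$ is the least set of literals that includes $\sigma$ and satisfies all static laws of $D$ (for each $\mathbf{if}(l,\varphi)\in D$, if it includes $\varphi$ then it contains $l$). An a-state is a consistent set of literals satisfying all static laws; a state is a complete a-state (it contains $f$ or $\neg f$ for every $f\in\mathbf F$); an a-state is valid if it is included in a state. Action $a$ is executable in $\delta$ if $\psi\subseteq\delta$ for some $\mathbf{executable}(a,\psi)\in D$. Let $E(a,\delta)=\{l\mid \mathbf{causes}(a,l,\phi)\in D,\ \phi\subseteq\delta\}$. $D$ is consistent if for every state $s$ and every non-sensing $a$ executable in $s$ there is a state $s'=Cl_D(E(a,s)\cup(s\cap s'))$. The initial a-state is $\delta_0=Cl_D(\{l\mid\mathbf{initially}(l)\in I\})$. The action theory $(D,I)$ is consistent if $D$ is consistent and $\delta_0$ is a valid a-state. Let $e(a,\delta)=Cl_D(E(a,\delta))$ and $pc(a,\delta)=\bigcup_{i\ge 0}pc^i(a,\delta)$, where $pc^0(a,\delta)=\{l\notin\delta\mid \mathbf{causes}(a,l,\phi)\in D,\ \neg\phi\cap\delta=\emptyset\}$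 and $pc^{i+1}(a,\delta)=pc^i(a,\delta)\cup\{l\notin\delta\mid \mathbf{if}(l,\varphi)\in D,\ \varphi\cap pc^i(a,\delta)\ne\emptyset,\ \neg\varphi\cap e(a,\delta)=\emptyset\}$. If $a$ is not executable in $\delta$, then $\Phi(a,\delta)=\bot$. Otherwise, if $a$ is non-sensing, $\Phi(a,\delta)$ is $\{\delta'\}$ with $\delta'=Cl_D(e(a,\delta)\cup(\delta\setminus\neg pc(a,\delta)))$ if $\delta'$ is consistent, and $\emptyset$ if it is not; if $a$ is sensing with $\mathbf{determines}(a,\theta)$, $\Phi(a,\delta)$ is the set of the consistent sets among $Cl_D(\delta\cup\{g\})$, $g\in\theta$. Conditional plans are $[\,]$; $[a;q]$ with $a$ non-sensing and $q$ a plan; and $[a;\mathbf{cases}(\{g\to p_g\}_{g\in\theta})]$ with $\mathbf{determines}(a,\theta)\in D$ and plans $p_g$. Put $\hat\Phi([\,],\delta)=\{\delta\}$; $\hat\Phi([a;q],\delta)=\bigcup_{\delta'\in\Phi(a,\delta)}\hat\Phi(q,\delta')$; $\hat\Phi([a;\mathbf{cases}(\{g\to p_g\}_{g\in\theta})],\delta)=\bigcup_{\delta'\in\Phi(a,\delta),\,g\in\theta\cap\delta'}\hat\Phi(p_g,\delta')$;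 the value is $\bot$ if $\Phi(a,\delta)=\bot$ or if some member of the union is $\bot$. A plan $p$ is a solution to $P$ if $\hat\Phi(p,\delta_0)\ne\bot$ and $\delta\models G$ for every $\delta\in\hat\Phi(p,\delta_0)$. **Reduct.** $\mathtt{reduct}_\delta(p)=[\,]$ if $p=[\,]$ or $\delta\models G$. Otherwise: for $p=[a;q]$ it is $[a;\mathtt{reduct}_{\delta'}(q)]$ if $\Phi(a,\delta)=\{\delta'\}$ for some $\delta'$, and $[a;[\,]]$ if not; for $p=[a;\mathbf{cases}(\{g\to p_g\}_{g\in\theta})]$ it is $\mathtt{reduct}_\delta(p_g)$ if some $g\in\theta$ is in $\delta$, and $[a;\mathbf{cases}(\{g\to q_g\}_{g\in\theta})]$ if not, with $q_g=[\,]$ if $Cl_D(\delta\cup\{g\})$ is inconsistent and $q_g=\mathtt{reduct}_{Cl_D(\delta\cup\{g\})}(p_g)$ otherwise. **Encoding.** For integers $h,w\ge 1$, $\pi_{h,w}(P)$ is the following ground program, where $t$ ranges over $1..h$, $t_1$ over $1..h+1$, $k,k_1,k_2$ over $1..w$, $L,L'$ over literals, $f$ over fluents, $a$ over actions (in rules that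 come from a proposition of $D$, $a$ is the action of that proposition), $g,g_1,g_2$ over sensed literals (members of some $\theta$), and $r(\gamma,\dots)$ stands for $\{r(x,\dots)\mid x\in\gamma\}$. * Facts $time(t)$, $time1(t_1)$, $path(k)$, $action(a)$, $fluent(f)$, $sense(g)$, $literal(f)$, $literal(\neg f)$, $contrary(f,\neg f)$, $contrary(\neg f,f)$, $new\_br(k,k_1)$ for $k\le k_1$, $used(1,1)$, and $holds(l,1,1)$ for each $\mathbf{initially}(l)\in I$. * For $\mathbf{executable}(a,\psi)$: $poss(a,t,k)\leftarrow holds(\psi,t,k)$. * For $\mathbf{causes}(a,l,\phi)$: $e(l,t,k)\leftarrow occ(a,t,k),holds(\phi,t,k)$; $\ pc(l,t,k)\leftarrow occ(a,t,k),\mathrm{not}\,holds(l,t,k),\mathrm{not}\,holds(\neg\phi,t,k)$. * For $\mathbf{determines}(a,\theta)$: $\leftarrow occ(a,t,k),\mathrm{not}\,br(\theta,t,k,k)$; and for each $g\in\theta$: $1\{br(g,t,k,x): k\le x\le w\}1\leftarrow occ(a,t,k)$; $\ \leftarrow occ(a,t,k),holds(g,t,k)$. * For $\mathbf{if}(l,\varphi)$: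 $pc(l,t,k)\leftarrow \mathrm{not}\,holds(l,t,k),pc(l',t,k),\mathrm{not}\,e(\neg\varphi,t,k)$ for each $l'\in\varphi$; $\ e(l,t,k)\leftarrow e(\varphi,t,k)$; $\ holds(l,t_1,k)\leftarrow holds(\varphi,t_1,k)$. * $goal(t_1,k)\leftarrow holds(G,t_1,k)$; $\ goal(t_1,k)\leftarrow contrary(L,L'),holds(L,t_1,k),holds(L',t_1,k)$; $\ \leftarrow used(h+1,k),\mathrm{not}\,goal(h+1,k)$. * $holds(L,t+1,k)\leftarrow e(L,t,k)$; $\ holds(L,t+1,k)\leftarrow holds(L,t,k),contrary(L,L'),\mathrm{not}\,pc(L',t,k)$. * $\leftarrow br(g_1,t,k_1,k),br(g_2,t,k_2,k)$ for $k_1<k_2<k$; $\ \leftarrow br(g_1,t,k_1,k),br(g_2,t,k_1,k)$ for $k_1\le k$, $g_1\ne g_2$; $\ \leftarrow br(g,t,k_1,k),used(t,k)$ for $k_1<k$; $\ used(t+1,k)\leftarrow br(g,t,k_1,k)$ for $k_1<k$; $\ holds(g,t+1,k)\leftarrow br(g,t,k_1,k)$ for $k_1\le k$; $\ holds(L,t+1,k)\leftarrow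 br(g,t,k_1,k),holds(L,t,k_1)$ for $k_1<k$. * $1\{occ(x,t,k): x\in\mathbf A\}1\leftarrow used(t,k),\mathrm{not}\,goal(t,k)$; $\ \leftarrow occ(a,t,k),\mathrm{not}\,poss(a,t,k)$; $\ used(t+1,k)\leftarrow used(t,k)$. A set of atoms $S$ is an answer set of such a program if it satisfies all rules (a head $1\{X\}1$ holds in $S$ if exactly one element of $X$ is in $S$; an empty head never holds) and is the least model of the definite program consisting of the rules $x\leftarrow B^+$ for every rule with positive body $B^+$ none of whose negated atoms is in $S$ and whose head is the atom $x$ or is $1\{X\}1$ with $x\in X\cap S$. **Extraction.** For $1\le i\le h+1$, $1\le k\le w$, $p^k_i(S)$ is $[\,]$ if $i=h+1$ or no $occ(a,i,k)$ is in $S$; $[a;p^k_{i+1}(S)]$ if $occ(a,i,k)\in S$ with $a$ non-sensing; and $[a;\mathbf{cases}(\{g\to p^{k_g}_{i+1}(S)\}_{g\in\theta})]$ if $occ(a,i,k)\in S$ with $a$ sensing, $\mathbf{determines}(a,\theta)\in D$, and $br(g,i,k,k_g)\in S$ for each $g\in\theta$. **Theorem.** Let $P=(D,I,G)$ be a planning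 problem instance whose action theory $(D,I)$ is consistent, let $\delta_0$ be its initial a-state, and let $p$ be a solution to $P$. Then there exist integers $h\ge 1$ and $w\ge 1$ such that $\pi_{h,w}(P)$ has an answer set $S$ for which $p^1_1(S)$ is well defined and $p^1_1(S)=\mathtt{reduct}_{\delta_0}(p)$. -/

import Mathlib

/-!
# Conditional planning with sensing actions and static causal laws, and its answer set encoding
-/

namespace ASCP

open Classical in
/-- Union of a family of sets some of which may be undefined (`none` plays the role of `⊥`),
with the convention `… ∪ ⊥ ∪ … = ⊥`. -/
noncomputable def unionBot {ι β : Type*} (I : Set ι) (f : ι → Option (Set β)) :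
    Option (Set β) :=
  if ∃ i ∈ I, f i = none then none
  else some {x | ∃ i ∈ I, ∃ Y, f i = some Y ∧ x ∈ Y}

/-! ## The action language -/

/-- Fluent literals over the set `F` of fluents. -/
inductive Lit (F : Type*) where
  | pos (f : F) : Lit F
  | neg (f : F) : Lit F

/-- The complementary literal. -/
def Lit.compl {F : Type*} : Lit F → Lit F
  | .pos f => .neg f
  | .neg f => .pos f

/-- The set of complements of the members of a set of literals. -/
def complSet {F : Type*} (σ : Set (Lit F)) : Set (Lit F) := Lit.compl '' σ

/-- A set of literals is consistent if it does not contain two complementary literals. -/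
def Consistent {F : Type*} (σ : Set (Lit F)) : Prop := ∀ l ∈ σ, l.compl ∉ σ

/-- A domain description over the fluents `F` and the actions `A`, sorted by the kind of the
propositions:
* `(a, ψ) ∈ exec` is the executability condition `executable(a, ψ)`;
* `(a, l, φ) ∈ causes` is the dynamic causal law `causes(a, l, φ)`;
* `(l, φ) ∈ statics` is the static causal law `if(l, φ)`;
* `(a, θ) ∈ determines` is the knowledge proposition `determines(a, θ)`. -/
structure Domain (F A : Type*) where
  exec : Set (A × Set (Lit F))
  causes : Set (A × Lit F × Set (Lit F))
  statics : Set (Lit F × Set (Lit F))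
  determines : Set (A × Set (Lit F))

namespace Domain

variable {F A : Type*} (D : Domain F A)

/-- Sensing actions are the ones that occur in a knowledge proposition; every other action is
non-sensing. -/
def IsSensing (a : A) : Prop := ∃ θ, (a, θ) ∈ D.determines

/-- The requirements on the propositions of a domain description. -/
structure WellFormed : Prop where
  /-- no static causal law has an empty body -/
  body_nonempty : ∀ l φ, (l, φ) ∈ D.statics → φ.Nonempty
  /-- at least two literals are sensed -/
  sensed_nontrivial : ∀ a θ, (a, θ) ∈ D.determines → θ.Nontrivial
  /-- the sensed literals are two contrary literals, or the domain contains `oneof(θ)` -/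
  sensed_exclusive : ∀ a θ, (a, θ) ∈ D.determines →
    (∃ f : F, θ = {Lit.pos f, Lit.neg f}) ∨
    ((∀ g ∈ θ, ∀ g' ∈ θ, g ≠ g' → (g'.compl, {g}) ∈ D.statics) ∧
      ∀ g ∈ θ, (g, complSet (θ \ {g})) ∈ D.statics)
  /-- an action with a dynamic causal law is not a sensing action -/
  causes_nonsensing : ∀ a l φ, (a, l, φ) ∈ D.causes → ¬ D.IsSensing a
  /-- a sensing action occurs in at most one knowledge proposition -/
  determines_unique : ∀ a θ θ', (a, θ) ∈ D.determines → (a, θ') ∈ D.determines → θ = θ'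

/-- `σ` satisfies all static causal laws. -/
def SatStatics (σ : Set (Lit F)) : Prop :=
  ∀ l φ, (l, φ) ∈ D.statics → φ ⊆ σ → l ∈ σ

/-- `Cl_D(σ)`: the smallest set of literals that includes `σ` and satisfies all static laws. -/
def Cl (σ : Set (Lit F)) : Set (Lit F) := ⋂₀ {τ | σ ⊆ τ ∧ D.SatStatics τ}

/-- States: complete and consistent sets of literals satisfying all static laws. -/
def IsState (s : Set (Lit F)) : Prop :=
  (∀ f : F, Lit.pos f ∈ s ∨ Lit.neg f ∈ s) ∧ Consistent s ∧ D.SatStatics s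

/-- Approximate states. -/
def IsAState (δ : Set (Lit F)) : Prop := Consistent δ ∧ D.SatStatics δ

/-- An a-state is valid if it is a subset of some state. -/
def Valid (δ : Set (Lit F)) : Prop := D.IsAState δ ∧ ∃ s, D.IsState s ∧ δ ⊆ s

/-- `a` is executable in `δ`. -/
def Executable (a : A) (δ : Set (Lit F)) : Prop := ∃ ψ, (a, ψ) ∈ D.exec ∧ ψ ⊆ δ

/-- The direct effects `E(a, δ)`. -/
def direct (a : A) (δ : Set (Lit F)) : Set (Lit F) :=
  {l | ∃ φ, (a, l, φ) ∈ D.causes ∧ φ ⊆ δ}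

/-- The possible next states under complete information, `Res^c_D(a, s)`. -/
def resC (a : A) (s : Set (Lit F)) : Set (Set (Lit F)) :=
  {s' | D.IsState s' ∧ s' = D.Cl (D.direct a s ∪ (s ∩ s'))}

/-- Consistent domain descriptions. -/
def IsConsistent : Prop :=
  ∀ s, D.IsState s → ∀ a, ¬ D.IsSensing a → D.Executable a s → (D.resC a s).Nonempty

/-- `e(a, δ)`: what definitely holds next. -/
def e (a : A) (δ : Set (Lit F)) : Set (Lit F) := D.Cl (D.direct a δ)

/-- The sets `pc^i(a, δ)`. -/
def pcStep (a : A) (δ : Set (Lit F)) : ℕ → Set (Lit F)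
  | 0 => {l | ∃ φ, (a, l, φ) ∈ D.causes ∧ l ∉ δ ∧ complSet φ ∩ δ = ∅}
  | i + 1 => pcStep a δ i ∪
      {l | ∃ φ, (l, φ) ∈ D.statics ∧ l ∉ δ ∧ (φ ∩ pcStep a δ i).Nonempty ∧
        complSet φ ∩ D.e a δ = ∅}

/-- `pc(a, δ)`: what may change. -/
def pc (a : A) (δ : Set (Lit F)) : Set (Lit F) := ⋃ i, D.pcStep a δ i

/-- `Cl_D(e(a, δ) ∪ (δ \ ¬pc(a, δ)))`. -/
def next (a : A) (δ : Set (Lit F)) : Set (Lit F) :=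
  D.Cl (D.e a δ ∪ (δ \ complSet (D.pc a δ)))

/-- The result function for non-sensing actions: `{next a δ}`, or `∅` if it is inconsistent. -/
def resNonsensing (a : A) (δ : Set (Lit F)) : Set (Set (Lit F)) :=
  {δ' | δ' = D.next a δ ∧ Consistent δ'}

/-- The result function for sensing actions. -/
def resSensing (a : A) (δ : Set (Lit F)) : Set (Set (Lit F)) :=
  {δ' | ∃ θ, (a, θ) ∈ D.determines ∧ ∃ g ∈ θ, δ' = D.Cl (δ ∪ {g}) ∧ Consistent δ'}

open Classical in
/-- The transition function `Φ`; `none` stands for `⊥`. -/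
noncomputable def Phi (a : A) (δ : Set (Lit F)) : Option (Set (Set (Lit F))) :=
  if D.Executable a δ then
    some (if D.IsSensing a then D.resSensing a δ else D.resNonsensing a δ)
  else none

end Domain

/-! ## Conditional plans -/

/-- Conditional plans of a domain description: the empty plan, `[a; p]` for a non-sensing `a`,
and `[a; cases({g → p_g}_{g ∈ θ})]` for a sensing `a` with `determines(a, θ)`. -/
inductive Plan {F A : Type*} (D : Domain F A) where
  | empty : Plan D
  | act (a : A) (ha : ¬ D.IsSensing a) (p : Plan D) : Plan D
  | sense (a : A) (θ : Set (Lit F)) (ha : (a, θ) ∈ D.determines) (p : θ → Plan D) : Plan D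

/-- The extended transition function. -/
noncomputable def PhiHat {F A : Type*} {D : Domain F A} :
    Plan D → Set (Lit F) → Option (Set (Set (Lit F)))
  | .empty => fun δ => some {δ}
  | .act a _ q => fun δ =>
      match D.Phi a δ with
      | none => none
      | some X => unionBot X (fun δ' => PhiHat q δ')
  | .sense a θ _ p => fun δ =>
      match D.Phi a δ with
      | none => none
      | some X => unionBot {x : θ × Set (Lit F) | x.2 ∈ X ∧ x.1.1 ∈ x.2}
          (fun x => PhiHat (p x.1) x.2)

/-- A planning problem instance: a domain description, the set of the literals `l` with
`initially(l)`, and a goal (a conjunction of literals). -/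
structure Problem (F A : Type*) where
  D : Domain F A
  I : Set (Lit F)
  G : Set (Lit F)

namespace Problem

variable {F A : Type*} (P : Problem F A)

/-- The initial a-state. -/
def initialState : Set (Lit F) := P.D.Cl P.I

/-- Consistency of the action theory: the domain is consistent and the initial a-state valid. -/
def IsConsistent : Prop := P.D.IsConsistent ∧ P.D.Valid P.initialState

/-- `p` is a solution: it is executable in the initial a-state and the goal holds in every
resulting a-state. -/
def IsSolution (p : Plan P.D) : Prop :=
  ∃ X, PhiHat p P.initialState = some X ∧ ∀ δ ∈ X, P.G ⊆ δ

open Classical in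
/-- `reduct_δ(p)`. -/
noncomputable def reduct : Plan P.D → Set (Lit F) → Plan P.D
  | .empty => fun _ => .empty
  | .act a ha q => fun δ =>
      if P.G ⊆ δ then .empty
      else if h : ∃ δ', P.D.Phi a δ = some {δ'} then .act a ha (reduct q h.choose)
      else .act a ha .empty
  | .sense a θ ha p => fun δ =>
      if P.G ⊆ δ then .empty
      else if h : ∃ g : θ, g.1 ∈ δ then reduct (p h.choose) δ
      else .sense a θ ha (fun g =>
        if Consistent (P.D.Cl (δ ∪ {g.1})) then reduct (p g) (P.D.Cl (δ ∪ {g.1}))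
        else .empty)

end Problem

/-! ## Ground logic programs and answer sets -/

/-- Heads of ground rules: an atom, nothing (the rule is a constraint), or `1{X}1`. -/
inductive Head (α : Type*) where
  | atom (x : α) : Head α
  | none : Head α
  | exactlyOne (X : Set α) : Head α

/-- A ground rule `head ← pos, not neg`. -/
structure Rule (α : Type*) where
  head : Head α
  pos : Set α
  neg : Set α

/-- Satisfaction of a head in a set of atoms. -/
def Head.Sat {α : Type*} (S : Set α) : Head α → Prop
  | .atom x => x ∈ S
  | .none => False
  | .exactlyOne X => ∃! x, x ∈ X ∧ x ∈ S

/-- Satisfaction of a rule. -/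
def Rule.Sat {α : Type*} (S : Set α) (r : Rule α) : Prop :=
  r.pos ⊆ S → r.neg ∩ S = ∅ → r.head.Sat S

/-- The atoms that a head supports, relative to the candidate `S`: a choice head supports those
of its atoms that are in `S`. -/
def Head.supports {α : Type*} (S : Set α) : Head α → Set α
  | .atom x => {x}
  | .none => ∅
  | .exactlyOne X => X ∩ S

/-- The reduct of a program relative to `S`, a set of definite rules `x ← B`. -/
def glReduct {α : Type*} (Q : Set (Rule α)) (S : Set α) : Set (α × Set α) :=
  {d | ∃ r ∈ Q, r.neg ∩ S = ∅ ∧ d.1 ∈ r.head.supports S ∧ d.2 = r.pos}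

/-- The least model of a definite program. -/
def leastModel {α : Type*} (R : Set (α × Set α)) : Set α :=
  ⋂₀ {T | ∀ d ∈ R, d.2 ⊆ T → d.1 ∈ T}

/-- Answer sets (stable models) of programs with normal rules, constraints and rules with heads
`1{X}1`: `S` satisfies every rule and is the least model of the reduct relative to `S`. -/
def IsAnswerSet {α : Type*} (Q : Set (Rule α)) (S : Set α) : Prop :=
  (∀ r ∈ Q, r.Sat S) ∧ S = leastModel (glReduct Q S)

/-! ## The encoding -/

/-- Ground atoms of the encoding. -/
inductive Atom (F A : Type*) where
  | time (t : ℕ)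
  | time1 (t : ℕ)
  | path (k : ℕ)
  | fluent (f : F)
  | literal (l : Lit F)
  | contrary (l l' : Lit F)
  | isSensed (g : Lit F)
  | action (a : A)
  | holds (l : Lit F) (t k : ℕ)
  | poss (a : A) (t k : ℕ)
  | occ (a : A) (t k : ℕ)
  | e (l : Lit F) (t k : ℕ)
  | pc (l : Lit F) (t k : ℕ)
  | goal (t k : ℕ)
  | br (g : Lit F) (t k k' : ℕ)
  | used (t k : ℕ)
  | newBr (k k' : ℕ)

/-- `holds(γ, t, k)` for a set `γ` of literals. -/
def holdsSet {F A : Type*} (γ : Set (Lit F)) (t k : ℕ) : Set (Atom F A) :=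
  {x | ∃ l ∈ γ, x = .holds l t k}

/-- `e(γ, t, k)` for a set `γ` of literals. -/
def eSet {F A : Type*} (γ : Set (Lit F)) (t k : ℕ) : Set (Atom F A) :=
  {x | ∃ l ∈ γ, x = .e l t k}

/-- `br(γ, t, k, k')` for a set `γ` of literals. -/
def brSet {F A : Type*} (γ : Set (Lit F)) (t k k' : ℕ) : Set (Atom F A) :=
  {x | ∃ g ∈ γ, x = .br g t k k'}

/-- Sensed literals. -/
def Domain.sensed {F A : Type*} (D : Domain F A) : Set (Lit F) :=
  {g | ∃ a θ, (a, θ) ∈ D.determines ∧ g ∈ θ}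

/-- The ground rules of the encoding with parameters `h` and `w`. The variables range over
their sorts: `t` over `1..h` (or over `1..h+1` where this is stated), `k, k₁, k₂` over `1..w`,
`g, g₁, g₂` over the sensed literals. Comparisons are evaluated, and the conditions in the heads
`1{br(g, t, k, x) : new_br(k, x)}1` and `1{occ(x, t, k) : action(x)}1` are expanded. -/
inductive IsRule {F A : Type*} (P : Problem F A) (h w : ℕ) : Rule (Atom F A) → Prop where
  -- sorts
  | time (t : ℕ) (ht : t ∈ Set.Icc 1 h) : IsRule P h w ⟨.atom (.time t), ∅, ∅⟩
  | time1 (t : ℕ) (ht : t ∈ Set.Icc 1 (h + 1)) : IsRule P h w ⟨.atom (.time1 t), ∅, ∅⟩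
  | path (k : ℕ) (hk : k ∈ Set.Icc 1 w) : IsRule P h w ⟨.atom (.path k), ∅, ∅⟩
  | action (a : A) : IsRule P h w ⟨.atom (.action a), ∅, ∅⟩
  | fluent (f : F) : IsRule P h w ⟨.atom (.fluent f), ∅, ∅⟩
  | isSensed (g : Lit F) (hg : g ∈ P.D.sensed) : IsRule P h w ⟨.atom (.isSensed g), ∅, ∅⟩
  -- initial situation
  | initially (l : Lit F) (hl : l ∈ P.I) : IsRule P h w ⟨.atom (.holds l 1 1), ∅, ∅⟩
  -- executability conditions
  | executable (a : A) (ψ : Set (Lit F)) (ha : (a, ψ) ∈ P.D.exec)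
      (t k : ℕ) (ht : t ∈ Set.Icc 1 h) (hk : k ∈ Set.Icc 1 w) :
      IsRule P h w ⟨.atom (.poss a t k), holdsSet ψ t k, ∅⟩
  -- dynamic causal laws
  | causes_e (a : A) (l : Lit F) (φ : Set (Lit F)) (ha : (a, l, φ) ∈ P.D.causes)
      (t k : ℕ) (ht : t ∈ Set.Icc 1 h) (hk : k ∈ Set.Icc 1 w) :
      IsRule P h w ⟨.atom (.e l t k), {.occ a t k} ∪ holdsSet φ t k, ∅⟩
  | causes_pc (a : A) (l : Lit F) (φ : Set (Lit F)) (ha : (a, l, φ) ∈ P.D.causes)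
      (t k : ℕ) (ht : t ∈ Set.Icc 1 h) (hk : k ∈ Set.Icc 1 w) :
      IsRule P h w ⟨.atom (.pc l t k), {.occ a t k},
        {.holds l t k} ∪ holdsSet (complSet φ) t k⟩
  -- knowledge propositions
  | determines_stay (a : A) (θ : Set (Lit F)) (ha : (a, θ) ∈ P.D.determines)
      (t k : ℕ) (ht : t ∈ Set.Icc 1 h) (hk : k ∈ Set.Icc 1 w) :
      IsRule P h w ⟨.none, {.occ a t k}, brSet θ t k k⟩
  | determines_branch (a : A) (θ : Set (Lit F)) (ha : (a, θ) ∈ P.D.determines)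
      (g : Lit F) (hg : g ∈ θ)
      (t k : ℕ) (ht : t ∈ Set.Icc 1 h) (hk : k ∈ Set.Icc 1 w) :
      IsRule P h w ⟨.exactlyOne {y | ∃ x ∈ Set.Icc 1 w, k ≤ x ∧ y = .br g t k x},
        {.occ a t k}, ∅⟩
  | determines_unknown (a : A) (θ : Set (Lit F)) (ha : (a, θ) ∈ P.D.determines)
      (g : Lit F) (hg : g ∈ θ)
      (t k : ℕ) (ht : t ∈ Set.Icc 1 h) (hk : k ∈ Set.Icc 1 w) :
      IsRule P h w ⟨.none, {.occ a t k, .holds g t k}, ∅⟩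
  -- static causal laws
  | static_pc (l : Lit F) (φ : Set (Lit F)) (hl : (l, φ) ∈ P.D.statics)
      (l' : Lit F) (hl' : l' ∈ φ)
      (t k : ℕ) (ht : t ∈ Set.Icc 1 h) (hk : k ∈ Set.Icc 1 w) :
      IsRule P h w ⟨.atom (.pc l t k), {.pc l' t k},
        {.holds l t k} ∪ eSet (complSet φ) t k⟩
  | static_e (l : Lit F) (φ : Set (Lit F)) (hl : (l, φ) ∈ P.D.statics)
      (t k : ℕ) (ht : t ∈ Set.Icc 1 h) (hk : k ∈ Set.Icc 1 w) :
      IsRule P h w ⟨.atom (.e l t k), eSet φ t k, ∅⟩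
  | static_holds (l : Lit F) (φ : Set (Lit F)) (hl : (l, φ) ∈ P.D.statics)
      (t k : ℕ) (ht : t ∈ Set.Icc 1 (h + 1)) (hk : k ∈ Set.Icc 1 w) :
      IsRule P h w ⟨.atom (.holds l t k), holdsSet φ t k, ∅⟩
  -- goal
  | goal (t k : ℕ) (ht : t ∈ Set.Icc 1 (h + 1)) (hk : k ∈ Set.Icc 1 w) :
      IsRule P h w ⟨.atom (.goal t k), holdsSet P.G t k, ∅⟩
  | goal_inconsistent (l l' : Lit F)
      (t k : ℕ) (ht : t ∈ Set.Icc 1 (h + 1)) (hk : k ∈ Set.Icc 1 w) :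
      IsRule P h w ⟨.atom (.goal t k),
        {.contrary l l', .holds l t k, .holds l' t k}, ∅⟩
  | goal_reached (k : ℕ) (hk : k ∈ Set.Icc 1 w) :
      IsRule P h w ⟨.none, {.used (h + 1) k}, {.goal (h + 1) k}⟩
  -- effects of non-sensing actions and inertia
  | effect (l : Lit F) (t k : ℕ) (ht : t ∈ Set.Icc 1 h) (hk : k ∈ Set.Icc 1 w) :
      IsRule P h w ⟨.atom (.holds l (t + 1) k), {.e l t k}, ∅⟩
  | inertia (l l' : Lit F) (t k : ℕ) (ht : t ∈ Set.Icc 1 h) (hk : k ∈ Set.Icc 1 w) :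
      IsRule P h w ⟨.atom (.holds l (t + 1) k),
        {.holds l t k, .contrary l l'}, {.pc l' t k}⟩
  -- branches created by sensing actions
  | branch_source (g₁ g₂ : Lit F) (hg₁ : g₁ ∈ P.D.sensed) (hg₂ : g₂ ∈ P.D.sensed)
      (t k₁ k₂ k : ℕ) (ht : t ∈ Set.Icc 1 h) (hk₁ : k₁ ∈ Set.Icc 1 w)
      (hk₂ : k₂ ∈ Set.Icc 1 w) (hk : k ∈ Set.Icc 1 w) (h₁₂ : k₁ < k₂) (h₂ : k₂ < k) :
      IsRule P h w ⟨.none, {.br g₁ t k₁ k, .br g₂ t k₂ k}, ∅⟩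
  | branch_label (g₁ g₂ : Lit F) (hg₁ : g₁ ∈ P.D.sensed) (hg₂ : g₂ ∈ P.D.sensed)
      (t k₁ k : ℕ) (ht : t ∈ Set.Icc 1 h) (hk₁ : k₁ ∈ Set.Icc 1 w)
      (hk : k ∈ Set.Icc 1 w) (h₁ : k₁ ≤ k) (hne : g₁ ≠ g₂) :
      IsRule P h w ⟨.none, {.br g₁ t k₁ k, .br g₂ t k₁ k}, ∅⟩
  | branch_fresh (g : Lit F) (hg : g ∈ P.D.sensed)
      (t k₁ k : ℕ) (ht : t ∈ Set.Icc 1 h) (hk₁ : k₁ ∈ Set.Icc 1 w)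
      (hk : k ∈ Set.Icc 1 w) (h₁ : k₁ < k) :
      IsRule P h w ⟨.none, {.br g t k₁ k, .used t k}, ∅⟩
  | branch_used (g : Lit F) (hg : g ∈ P.D.sensed)
      (t k₁ k : ℕ) (ht : t ∈ Set.Icc 1 h) (hk₁ : k₁ ∈ Set.Icc 1 w)
      (hk : k ∈ Set.Icc 1 w) (h₁ : k₁ < k) :
      IsRule P h w ⟨.atom (.used (t + 1) k), {.br g t k₁ k}, ∅⟩
  | branch_sensed (g : Lit F) (hg : g ∈ P.D.sensed)
      (t k₁ k : ℕ) (ht : t ∈ Set.Icc 1 h) (hk₁ : k₁ ∈ Set.Icc 1 w)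
      (hk : k ∈ Set.Icc 1 w) (h₁ : k₁ ≤ k) :
      IsRule P h w ⟨.atom (.holds g (t + 1) k), {.br g t k₁ k}, ∅⟩
  | branch_inherit (g : Lit F) (hg : g ∈ P.D.sensed) (l : Lit F)
      (t k₁ k : ℕ) (ht : t ∈ Set.Icc 1 h) (hk₁ : k₁ ∈ Set.Icc 1 w)
      (hk : k ∈ Set.Icc 1 w) (h₁ : k₁ < k) :
      IsRule P h w ⟨.atom (.holds l (t + 1) k), {.br g t k₁ k, .holds l t k₁}, ∅⟩
  -- action occurrences
  | occ_choice (t k : ℕ) (ht : t ∈ Set.Icc 1 h) (hk : k ∈ Set.Icc 1 w) :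
      IsRule P h w ⟨.exactlyOne {y | ∃ a : A, y = .occ a t k}, {.used t k}, {.goal t k}⟩
  | occ_poss (a : A) (t k : ℕ) (ht : t ∈ Set.Icc 1 h) (hk : k ∈ Set.Icc 1 w) :
      IsRule P h w ⟨.none, {.occ a t k}, {.poss a t k}⟩
  -- auxiliary rules
  | literal_pos (f : F) : IsRule P h w ⟨.atom (.literal (.pos f)), ∅, ∅⟩
  | literal_neg (f : F) : IsRule P h w ⟨.atom (.literal (.neg f)), ∅, ∅⟩
  | contrary_pos (f : F) : IsRule P h w ⟨.atom (.contrary (.pos f) (.neg f)), ∅, ∅⟩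
  | contrary_neg (f : F) : IsRule P h w ⟨.atom (.contrary (.neg f) (.pos f)), ∅, ∅⟩
  | newBr (k k₁ : ℕ) (hk : k ∈ Set.Icc 1 w) (hk₁ : k₁ ∈ Set.Icc 1 w) (hle : k ≤ k₁) :
      IsRule P h w ⟨.atom (.newBr k k₁), ∅, ∅⟩
  | used_root : IsRule P h w ⟨.atom (.used 1 1), ∅, ∅⟩
  | used_next (t k : ℕ) (ht : t ∈ Set.Icc 1 h) (hk : k ∈ Set.Icc 1 w) :
      IsRule P h w ⟨.atom (.used (t + 1) k), {.used t k}, ∅⟩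

/-- The program `π_{h,w}(P)`. -/
def program {F A : Type*} (P : Problem F A) (h w : ℕ) : Set (Rule (Atom F A)) :=
  {r | IsRule P h w r}

/-- `Extracts D h S i k q`: the plan `q` is (a value of) `p^k_i(S)`, the plan read off from the
set of atoms `S` at time `i` and path `k`. -/
inductive Extracts {F A : Type*} (D : Domain F A) (h : ℕ) (S : Set (Atom F A)) :
    ℕ → ℕ → Plan D → Prop where
  | empty (i k : ℕ) (hi : i = h + 1 ∨ ∀ a, Atom.occ a i k ∉ S) : Extracts D h S i k .empty
  | act (i k : ℕ) (hi : i ≤ h) (a : A) (ha : ¬ D.IsSensing a) (hocc : Atom.occ a i k ∈ S)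
      (q : Plan D) (hq : Extracts D h S (i + 1) k q) : Extracts D h S i k (.act a ha q)
  | sense (i k : ℕ) (hi : i ≤ h) (a : A) (θ : Set (Lit F)) (ha : (a, θ) ∈ D.determines)
      (hocc : Atom.occ a i k ∈ S) (κ : θ → ℕ) (hκ : ∀ g, Atom.br g.1 i k (κ g) ∈ S)
      (q : θ → Plan D) (hq : ∀ g, Extracts D h S (i + 1) (κ g) (q g)) :
      Extracts D h S i k (.sense a θ ha q)

end ASCP

/-! The answer set is written down directly: it records the execution of the reduced plan `q =
reduct p δ₀`, with `h = w = q.size`.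

Path numbers are allocated by size. A subplan running on path `k` reserves the `size` consecutive
numbers from `k` on, and the cases of a sensing node receive consecutive disjoint intervals inside
the interval of that node. Hence the subplans running at the same time reserve disjoint intervals
(`Reach.unique_or_disjoint`), which yields all the constraints on branching, and the case with
offset 0 stays on the path of its parent. Every action decreases the size, so no action remains at
time `h + 1` (`Reach.time_add_size_le`).

The reduct acts only in consistent sets where the goal fails, and it never senses a known literal.
These conditions, collected in `Achieves`, hold for the reduct of a solution (`achieves_reduct`) and
are inherited along the execution. They are what the rules for `goal`, `occ` and sensing ask for, so
the recorded set satisfies the program (`rule_sat_answerSet`). Conversely, induction along the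
execution puts each recorded atom into every model of the Gelfond–Lifschitz reduct
(`IsReductModel.answerSet_subset`), so the recorded set is the least model. Finally, a running
subplan is recovered uniquely from its time and path (`Reach.extracts_iff`). -/

namespace ASCP

variable {F A : Type*}

/-! ## Literals and closures -/

@[simp]
theorem Lit.compl_compl (l : Lit F) : l.compl.compl = l := by cases l <;> rfl

instance [Finite F] : Finite (Lit F) :=
  Finite.of_injective (β := F × Bool)
    (fun l => match l with
      | .pos f => (f, true)
      | .neg f => (f, false))
    (by rintro (f | f) (g | g) h <;> simp_all)

namespace Domain

variable {D : Domain F A}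

theorem subset_Cl (σ : Set (Lit F)) : σ ⊆ D.Cl σ := fun _ hl _ hτ => hτ.1 hl

theorem Cl_subset {σ τ : Set (Lit F)} (h : σ ⊆ τ) (hτ : D.SatStatics τ) : D.Cl σ ⊆ τ :=
  fun _ hl => hl τ ⟨h, hτ⟩

theorem satStatics_Cl (σ : Set (Lit F)) : D.SatStatics (D.Cl σ) :=
  fun l φ hlφ hφ τ hτ => hτ.2 l φ hlφ fun _ hm => hφ hm τ hτ

theorem Cl_eq_self {σ : Set (Lit F)} (hσ : D.SatStatics σ) : D.Cl σ = σ :=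
  (Cl_subset subset_rfl hσ).antisymm (subset_Cl σ)

theorem WellFormed.Cl_empty (hwf : D.WellFormed) : D.Cl ∅ = ∅ :=
  Cl_eq_self fun l φ hlφ hφ => ((hwf.body_nonempty l φ hlφ).mono hφ).ne_empty rfl |>.elim

/-- A sensing action has no dynamic law, and static laws with non-empty bodies derive nothing from
the empty set. -/
theorem WellFormed.e_sensing (hwf : D.WellFormed) {a : A} (ha : D.IsSensing a)
    (δ : Set (Lit F)) : D.e a δ = ∅ := by
  have : D.direct a δ = ∅ := by
    ext l
    simp only [direct, Set.mem_ofPred_eq, Set.mem_empty_iff_false, iff_false]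
    rintro ⟨φ, h, -⟩
    exact hwf.causes_nonsensing _ _ _ h ha
  rw [e, this, hwf.Cl_empty]

theorem WellFormed.pc_sensing (hwf : D.WellFormed) {a : A} (ha : D.IsSensing a)
    (δ : Set (Lit F)) : D.pc a δ = ∅ := by
  have (i : ℕ) : D.pcStep a δ i = ∅ := by
    induction i with
    | zero =>
      ext l
      simp only [pcStep, Set.mem_ofPred_eq, Set.mem_empty_iff_false, iff_false]
      rintro ⟨φ, h, -⟩
      exact hwf.causes_nonsensing _ _ _ h ha
    | succ i ih => simp [pcStep, ih]
  simp [pc, this]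

theorem pcStep_zero_subset_pc (a : A) (δ : Set (Lit F)) : D.pcStep a δ 0 ⊆ D.pc a δ :=
  Set.subset_iUnion (D.pcStep a δ) 0

theorem mem_pc_of_static {a : A} {δ : Set (Lit F)} {l l' : Lit F} {φ : Set (Lit F)}
    (h : (l, φ) ∈ D.statics) (hl : l ∉ δ) (hl' : l' ∈ φ) (hpc : l' ∈ D.pc a δ)
    (hφ : complSet φ ∩ D.e a δ = ∅) : l ∈ D.pc a δ := by
  obtain ⟨i, hi⟩ := Set.mem_iUnion.1 hpc
  exact Set.mem_iUnion.2 ⟨i + 1, Or.inr ⟨φ, h, hl, ⟨l', hl', hi⟩, hφ⟩⟩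

end Domain

theorem unionBot_eq_some {ι β : Type*} {I : Set ι} {f : ι → Option (Set β)} {X : Set β}
    (h : unionBot I f = some X) {i : ι} (hi : i ∈ I) : ∃ Y, f i = some Y ∧ Y ⊆ X := by
  unfold unionBot at h
  split_ifs at h with hn
  obtain ⟨Y, hY⟩ := Option.ne_none_iff_exists'.1 fun h' => hn ⟨i, hi, h'⟩
  refine ⟨Y, hY, fun x hx => ?_⟩
  rw [← Option.some.inj h]
  exact ⟨i, hi, Y, hY, hx⟩

/-! ## Reduced plans that achieve the goal -/

/-- The plan `q` is executable in `δ`, acts only where the goal does not hold yet, senses only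
what is not known, and ends in sets of literals that include the goal or are inconsistent. -/
inductive Achieves (P : Problem F A) : Set (Lit F) → Plan P.D → Prop where
  -- The inconsistent leaves are those where the reduct stops after an impossible outcome; the
  -- encoding treats them as goals.
  | empty (δ : Set (Lit F)) (h : P.G ⊆ δ ∨ ¬ Consistent δ) : Achieves P δ .empty
  | act (δ : Set (Lit F)) (a : A) (ha : ¬ P.D.IsSensing a) (q : Plan P.D)
      (hG : ¬ P.G ⊆ δ) (hδ : Consistent δ) (hex : P.D.Executable a δ)
      (hq : Achieves P (P.D.next a δ) q) : Achieves P δ (.act a ha q)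
  | sense (δ : Set (Lit F)) (a : A) (θ : Set (Lit F)) (ha : (a, θ) ∈ P.D.determines)
      (q : θ → Plan P.D) (hG : ¬ P.G ⊆ δ) (hδ : Consistent δ) (hex : P.D.Executable a δ)
      (hθ : ∀ g ∈ θ, g ∉ δ) (hq : ∀ g : θ, Achieves P (P.D.Cl (δ ∪ {g.1})) (q g)) :
      Achieves P δ (.sense a θ ha q)

/-- Since `⊥` and failure of the goal propagate through unions, being a solution passes to every
consistent successor, where the induction hypothesis applies; at inconsistent successors the reduct
is `[]`. -/
theorem achieves_reduct {P : Problem F A} (p : Plan P.D) {δ : Set (Lit F)}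
    (hδ : P.D.IsAState δ) (hp : ∃ X, PhiHat p δ = some X ∧ ∀ δ' ∈ X, P.G ⊆ δ') :
    Achieves P δ (P.reduct p δ) := by
  induction p generalizing δ with
  | empty =>
    obtain ⟨X, hX, hG⟩ := hp
    simp only [PhiHat, Option.some.injEq] at hX
    exact .empty _ (Or.inl (hG δ (by simp [← hX])))
  | act a ha q ih =>
    obtain ⟨X, hX, hG⟩ := hp
    simp only [Problem.reduct]
    split_ifs with h₁ h₂
    · exact .empty _ (Or.inl h₁)
    · by_cases hex : P.D.Executable a δ
      · have hPhi : P.D.Phi a δ = some (P.D.resNonsensing a δ) := by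
          simp [Domain.Phi, hex, ha]
        have hmem : h₂.choose ∈ P.D.resNonsensing a δ := by
          have := hPhi.symm.trans h₂.choose_spec
          exact (Option.some.inj this).symm ▸ Set.mem_singleton _
        simp only [PhiHat, hPhi] at hX
        obtain ⟨Y, hY, hYX⟩ := unionBot_eq_some hX hmem
        refine .act _ _ _ _ h₁ hδ.1 hex ?_
        rw [← hmem.1]
        refine ih ⟨hmem.2, ?_⟩ ⟨Y, hY, fun δ' h => hG _ (hYX h)⟩
        rw [hmem.1]
        exact Domain.satStatics_Cl _
      · simp [PhiHat, Domain.Phi, hex] at hX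
    · by_cases hex : P.D.Executable a δ
      -- The value of `Φ` is not a singleton, so `next a δ` must be inconsistent: otherwise it would
      -- be the only outcome.
      · refine .act _ _ _ _ h₁ hδ.1 hex (.empty _ (Or.inr fun hc => h₂ ⟨P.D.next a δ, ?_⟩))
        simp only [Domain.Phi, hex, ha, if_true, if_false, Option.some.injEq]
        ext δ'
        simp only [Domain.resNonsensing, Set.mem_ofPred_eq, Set.mem_singleton_iff]
        exact ⟨fun h => h.1, fun h => ⟨h, h ▸ hc⟩⟩
      · simp [PhiHat, Domain.Phi, hex] at hX
  | sense a θ ha q ih =>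
    obtain ⟨X, hX, hG⟩ := hp
    have hs : P.D.IsSensing a := ⟨θ, ha⟩
    have hex : P.D.Executable a δ := by
      by_contra hex
      simp [PhiHat, Domain.Phi, hex] at hX
    have hPhi : P.D.Phi a δ = some (P.D.resSensing a δ) := by
      simp [Domain.Phi, hex, hs]
    simp only [PhiHat, hPhi] at hX
    have key (g : θ) (hc : Consistent (P.D.Cl (δ ∪ {g.1}))) :
        Achieves P (P.D.Cl (δ ∪ {g.1})) (P.reduct (q g) (P.D.Cl (δ ∪ {g.1}))) := by
      obtain ⟨Y, hY, hYX⟩ := unionBot_eq_some hX (i := (g, P.D.Cl (δ ∪ {g.1})))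
        ⟨⟨θ, ha, g.1, g.2, rfl, hc⟩, Domain.subset_Cl _ (Or.inr rfl)⟩
      exact ih g ⟨hc, Domain.satStatics_Cl _⟩ ⟨Y, hY, fun δ' h => hG _ (hYX h)⟩
    simp only [Problem.reduct]
    split_ifs with h₁ h₂
    · exact .empty _ (Or.inl h₁)
    -- Sensing a known literal adds nothing, so `key` for that case speaks about `δ` itself.
    · have hg : P.D.Cl (δ ∪ {h₂.choose.1}) = δ := by
        rw [Set.union_eq_self_of_subset_right (Set.singleton_subset_iff.2 h₂.choose_spec),
          Domain.Cl_eq_self hδ.2]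
      have := key h₂.choose (by rw [hg]; exact hδ.1)
      rwa [hg] at this
    · refine .sense _ _ _ _ _ h₁ hδ.1 hex (fun g hg hgδ => h₂ ⟨⟨g, hg⟩, hgδ⟩) fun g => ?_
      split_ifs with hc
      · exact key g hc
      · exact .empty _ (Or.inr hc)

/-! ## Allocation of paths -/

section Offset

variable {ι : Type*} [Finite ι]

open Classical in
/-- The start of the `i`-th interval when consecutive intervals of lengths `L j` are laid out
from `0` on. -/
noncomputable def offset (L : ι → ℕ) (i : ι) : ℕ :=
  letI := Fintype.ofFinite ι
  ∑ j with Finite.equivFin ι j < Finite.equivFin ι i, L j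

theorem offset_add_le_finsum (L : ι → ℕ) (i : ι) : offset L i + L i ≤ ∑ᶠ j, L j := by
  classical
  let _ := Fintype.ofFinite ι
  rw [finsum_eq_sum_of_fintype, offset, add_comm, ← Finset.sum_insert (by simp)]
  exact Finset.sum_le_sum_of_subset (Finset.subset_univ _)

theorem offset_add_le_offset (L : ι → ℕ) {i j : ι}
    (h : Finite.equivFin ι i < Finite.equivFin ι j) : offset L i + L i ≤ offset L j := by
  classical
  let _ := Fintype.ofFinite ι
  rw [offset, add_comm, ← Finset.sum_insert (by simp), offset]
  refine Finset.sum_le_sum_of_subset fun m hm => ?_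
  simp only [Finset.mem_insert, Finset.mem_filter, Finset.mem_univ, true_and] at hm ⊢
  rcases hm with rfl | hm
  · exact h
  · exact hm.trans h

theorem offset_disjoint (L : ι → ℕ) {i j : ι} (h : i ≠ j) :
    offset L i + L i ≤ offset L j ∨ offset L j + L j ≤ offset L i := by
  rcases lt_or_gt_of_ne ((Finite.equivFin ι).injective.ne h) with h | h
  · exact Or.inl (offset_add_le_offset L h)
  · exact Or.inr (offset_add_le_offset L h)

/-- The first case in the enumeration remains on the path of the sensing node, as the constraint
`determines_stay` demands. -/
theorem exists_offset_eq_zero [Nonempty ι] (L : ι → ℕ) : ∃ i, offset L i = 0 := by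
  classical
  let _ := Fintype.ofFinite ι
  obtain ⟨i, hi⟩ := Finite.exists_min (Finite.equivFin ι)
  refine ⟨i, ?_⟩
  rw [offset, Finset.filter_false_of_mem fun j _ => not_lt.2 (hi j), Finset.sum_empty]

end Offset

/-! ### Size and first action of a plan -/

namespace Plan

variable {D : Domain F A}

/-- The number of nodes of a plan. -/
noncomputable def size : Plan D → ℕ
  | .empty => 1
  | .act _ _ q => 1 + size q
  | .sense _ _ _ q => 1 + ∑ᶠ g, size (q g)

theorem size_pos (q : Plan D) : 0 < q.size := by
  cases q <;> simp [size]

/-- The first action of a plan. -/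
def first : Plan D → Option A
  | .empty => none
  | .act a _ _ => some a
  | .sense a _ _ _ => some a

theorem exists_first {q : Plan D} (h : q ≠ .empty) :
    ∃ a, q.first = some a := by
  cases q with
  | empty => exact (h rfl).elim
  | act a => exact ⟨a, rfl⟩
  | sense a => exact ⟨a, rfl⟩

theorem first_eq_some_sensing (hwf : D.WellFormed) {q : Plan D} {a : A} {θ : Set (Lit F)}
    (hq : q.first = some a) (ha : (a, θ) ∈ D.determines) : ∃ r, q = .sense a θ ha r := by
  cases q with
  | empty => simp [first] at hq
  | act b hb r =>
    obtain rfl : b = a := by simpa [first] using hq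
    exact (hb ⟨θ, ha⟩).elim
  | sense b θ' hb r =>
    obtain rfl : b = a := by simpa [first] using hq
    obtain rfl := hwf.determines_unique _ _ _ hb ha
    exact ⟨r, rfl⟩

theorem first_eq_some_nonsensing {q : Plan D} {a : A}
    (hq : q.first = some a) (ha : ¬ D.IsSensing a) : ∃ r, q = .act a ha r := by
  cases q with
  | empty => simp [first] at hq
  | act b hb r =>
    obtain rfl : b = a := by simpa [first] using hq
    exact ⟨r, rfl⟩
  | sense b θ' hb r =>
    obtain rfl : b = a := by simpa [first] using hq
    exact (ha ⟨θ', hb⟩).elim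

end Plan

theorem Achieves.of_ne_empty {P : Problem F A} {δ : Set (Lit F)} {q : Plan P.D} (h : Achieves P δ q)
    (hq : q ≠ .empty) : ¬ P.G ⊆ δ ∧ Consistent δ := by
  cases h with
  | empty => simp at hq
  | act _ _ _ _ hG hδ => exact ⟨hG, hδ⟩
  | sense _ _ _ _ _ hG hδ => exact ⟨hG, hδ⟩

theorem Achieves.executable {P : Problem F A} {δ : Set (Lit F)} {q : Plan P.D} (h : Achieves P δ q) {a : A}
    (hq : q.first = some a) : P.D.Executable a δ := by
  cases h with
  | empty => simp [Plan.first] at hq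
  | act _ _ _ _ _ _ hex => simp only [Plan.first, Option.some.injEq] at hq; exact hq ▸ hex
  | sense _ _ _ _ _ _ _ hex => simp only [Plan.first, Option.some.injEq] at hq; exact hq ▸ hex

/-! ## Least models -/

theorem mem_leastModel {α : Type*} {R : Set (α × Set α)} {x : α} :
    x ∈ leastModel R ↔ ∀ T : Set α, (∀ d ∈ R, d.2 ⊆ T → d.1 ∈ T) → x ∈ T := Iff.rfl

/-- `S` is itself a model of its reduct: a choice head supports only atoms that are already in `S`.
-/
theorem leastModel_glReduct_subset {α : Type*} {Q : Set (Rule α)} {S : Set α}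
    (hS : ∀ r ∈ Q, r.Sat S) : leastModel (glReduct Q S) ⊆ S := by
  intro x hx
  refine mem_leastModel.1 hx S ?_
  rintro ⟨y, B⟩ ⟨r, hr, hneg, hy, rfl⟩ hB
  have := hS r hr hB hneg
  obtain ⟨hd, pos, neg⟩ := r
  cases hd with
  | atom z => exact (show y = z from hy) ▸ this
  | none => exact hy.elim
  | exactlyOne X => exact hy.2

/-! ## Execution -/

section Execution

variable [Finite F] {P : Problem F A} {p : Plan P.D} {T : Set (Atom F A)}

/-- One step of the execution on path `k`, in the set of literals `δ`, of a plan. The subplan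
`q` executed on path `k` reserves the paths from `k` to `k + q.size - 1`. -/
inductive Step (P : Problem F A) :
    ℕ → Set (Lit F) → Plan P.D → ℕ → Set (Lit F) → Plan P.D → Prop where
  -- A finished path goes on, since `used` and, by inertia, `holds` persist up to the horizon.
  | idle (k : ℕ) (δ : Set (Lit F)) : Step P k δ .empty k δ .empty
  | act (k : ℕ) (δ : Set (Lit F)) (a : A) (ha : ¬ P.D.IsSensing a) (q : Plan P.D) :
      Step P k δ (.act a ha q) k (P.D.next a δ) q
  | sense (k : ℕ) (δ : Set (Lit F)) (a : A) (θ : Set (Lit F)) (ha : (a, θ) ∈ P.D.determines)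
      (q : θ → Plan P.D) (g : θ) :
      Step P k δ (.sense a θ ha q) (k + offset (fun g => (q g).size) g)
        (P.D.Cl (δ ∪ {g.1})) (q g)

/-- `Reach P p t k δ q`: when `p` is executed from the initial state, then at time `t` path `k`
is in use, the literals known on it are those in `δ`, and the plan to be executed is `q`. -/
inductive Reach (P : Problem F A) (p : Plan P.D) :
    ℕ → ℕ → Set (Lit F) → Plan P.D → Prop where
  | root : Reach P p 1 1 P.initialState p
  | step {t k k' : ℕ} {δ δ' : Set (Lit F)} {q q' : Plan P.D} (h : Reach P p t k δ q)
      (hs : Step P k δ q k' δ' q') : Reach P p (t + 1) k' δ' q'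

namespace Reach

variable {t k k' : ℕ} {δ δ' : Set (Lit F)} {q q' : Plan P.D}

theorem one_le_time (h : Reach P p t k δ q) : 1 ≤ t := by
  cases h <;> simp

theorem cases_one (h : Reach P p 1 k δ q) : k = 1 ∧ δ = P.initialState ∧ q = p := by
  generalize ht : 1 = t at h
  cases h with
  | root => simp
  | step h _ => have := h.one_le_time; omega

theorem cases_succ (h : Reach P p (t + 1) k δ q) (ht : 1 ≤ t) :
    ∃ k₁ δ₁ q₁, Reach P p t k₁ δ₁ q₁ ∧ Step P k₁ δ₁ q₁ k δ q := by
  generalize hs : t + 1 = s at h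
  cases h with
  | root => omega
  | step h hst =>
    obtain rfl := Nat.succ.inj hs
    exact ⟨_, _, _, h, hst⟩

end Reach

/-- Reserved intervals are nested: the sizes of all cases sum to one less than the size of the
sensing node. -/
theorem Step.interval {k k' : ℕ} {δ δ' : Set (Lit F)} {q q' : Plan P.D}
    (h : Step P k δ q k' δ' q') : k ≤ k' ∧ k' + q'.size ≤ k + q.size := by
  cases h with
  | idle => simp
  | act => simp [Plan.size]
  | sense a θ ha q g =>
    have := offset_add_le_finsum (fun g => (q g).size) g
    simp only [Plan.size]
    omega

theorem Step.size_lt {k k' : ℕ} {δ δ' : Set (Lit F)} {q q' : Plan P.D}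
    (h : Step P k δ q k' δ' q') (hq : q ≠ .empty) : q'.size < q.size := by
  cases h with
  | idle => simp at hq
  | act => simp [Plan.size]
  | sense a θ ha q g =>
    have := offset_add_le_finsum (fun g => (q g).size) g
    simp only [Plan.size]
    omega

theorem Step.unique_or_disjoint {k k₁ k₂ : ℕ} {δ δ₁ δ₂ : Set (Lit F)} {q q₁ q₂ : Plan P.D}
    (h₁ : Step P k δ q k₁ δ₁ q₁) (h₂ : Step P k δ q k₂ δ₂ q₂) :
    (k₁ = k₂ ∧ δ₁ = δ₂ ∧ q₁ = q₂) ∨ k₁ + q₁.size ≤ k₂ ∨ k₂ + q₂.size ≤ k₁ := by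
  cases h₁ with
  | idle => cases h₂; simp
  | act => cases h₂; simp
  | sense a θ ha q g =>
    cases h₂ with
    | sense _ _ _ _ g' =>
      by_cases hg : g = g'
      · subst hg; simp
      · have := offset_disjoint (fun g => (q g).size) hg
        omega

namespace Reach

variable {t k k' : ℕ} {δ δ' : Set (Lit F)} {q q' : Plan P.D}

/-- If the predecessors coincide, a single step decides; if their intervals are disjoint, so are the
subintervals reserved by the successors. -/
theorem unique_or_disjoint (h : Reach P p t k δ q) (h' : Reach P p t k' δ' q') :
    (k = k' ∧ δ = δ' ∧ q = q') ∨ k + q.size ≤ k' ∨ k' + q'.size ≤ k := by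
  induction h generalizing k' δ' q' with
  | root =>
    obtain ⟨rfl, rfl, rfl⟩ := h'.cases_one
    simp
  | step h hs ih =>
    obtain ⟨k₁, δ₁, q₁, h₁, hs₁⟩ := h'.cases_succ h.one_le_time
    rcases ih h₁ with ⟨rfl, rfl, rfl⟩ | hd
    · exact hs.unique_or_disjoint hs₁
    · have := hs.interval
      have := hs₁.interval
      omega

theorem unique_of_mem (h : Reach P p t k δ q) (h' : Reach P p t k' δ' q') {m : ℕ}
    (hm : k ≤ m ∧ m < k + q.size) (hm' : k' ≤ m ∧ m < k' + q'.size) :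
    k = k' ∧ δ = δ' ∧ q = q' := by
  rcases h.unique_or_disjoint h' with h | h
  · exact h
  · omega

theorem unique (h : Reach P p t k δ q) (h' : Reach P p t k δ' q') : δ = δ' ∧ q = q' := by
  have := q.size_pos
  have := q'.size_pos
  exact (h.unique_of_mem h' (m := k) (by omega) (by omega)).2

theorem bounds (h : Reach P p t k δ q) : 1 ≤ k ∧ k + q.size ≤ 1 + p.size := by
  induction h with
  | root => simp
  | step _ hs ih =>
    have := hs.interval
    omega

theorem mem_Icc (h : Reach P p t k δ q) : k ∈ Set.Icc 1 p.size := by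
  have := h.bounds
  have := q.size_pos
  exact ⟨by omega, by omega⟩

/-- A path that has idled stays empty, so a non-empty subplan was reached by proper steps only, each
of which decreases the size. -/
theorem time_add_size_le (h : Reach P p t k δ q) (hq : q ≠ .empty) :
    t + q.size ≤ 1 + p.size := by
  induction h with
  | root => simp
  | @step _ _ _ _ _ q₁ _ _ hs ih =>
    by_cases h₁ : q₁ = .empty
    · subst h₁
      cases hs
      exact (hq rfl).elim
    · have := hs.size_lt h₁
      have := ih h₁
      omega

theorem time_mem_Icc (h : Reach P p t k δ q) (hq : q ≠ .empty) : t ∈ Set.Icc 1 p.size := by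
  have := h.time_add_size_le hq
  have := q.size_pos
  exact ⟨h.one_le_time, by omega⟩

theorem satStatics (h : Reach P p t k δ q) : P.D.SatStatics δ := by
  induction h with
  | root => exact Domain.satStatics_Cl _
  | step _ hs ih =>
    cases hs with
    | idle => exact ih
    | act => exact Domain.satStatics_Cl _
    | sense => exact Domain.satStatics_Cl _

theorem achieves (hp : Achieves P P.initialState p) (h : Reach P p t k δ q) :
    Achieves P δ q := by
  induction h with
  | root => exact hp
  | step _ hs ih =>
    cases hs with
    | idle => exact ih
    | act => cases ih; assumption
    | sense _ _ _ _ g =>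
      cases ih with
      | sense _ _ _ _ _ _ _ _ _ hq => exact hq g

end Reach

/-! ### The set of atoms that records the execution -/

/-- The literals known at time `t` on path `k`. -/
def known (P : Problem F A) (p : Plan P.D) (t k : ℕ) : Set (Lit F) :=
  {l | ∃ δ q, Reach P p t k δ q ∧ l ∈ δ}

theorem Reach.known_eq {t k : ℕ} {δ : Set (Lit F)} {q : Plan P.D} (h : Reach P p t k δ q) :
    known P p t k = δ := by
  ext l
  refine ⟨?_, fun hl => ⟨δ, q, h, hl⟩⟩
  rintro ⟨δ', q', h', hl⟩
  exact (h.unique h').1 ▸ hl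

/-- Action `a` occurs at time `t` on path `k`. -/
def Occurs (P : Problem F A) (p : Plan P.D) (a : A) (t k : ℕ) : Prop :=
  ∃ δ q, Reach P p t k δ q ∧ q.first = some a

/-- At time `t`, the case `g` of path `k` is continued on path `k'`. -/
def Branches (P : Problem F A) (p : Plan P.D) (g : Lit F) (t k k' : ℕ) : Prop :=
  ∃ δ a θ, ∃ ha : (a, θ) ∈ P.D.determines, ∃ q : θ → Plan P.D, ∃ hg : g ∈ θ,
    Reach P p t k δ (.sense a θ ha q) ∧ k' = k + offset (fun g => (q g).size) ⟨g, hg⟩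

/-- Membership in the answer set that describes the execution of `p`. -/
def InAnswerSet (P : Problem F A) (p : Plan P.D) : Atom F A → Prop
  | .time t => t ∈ Set.Icc 1 p.size
  | .time1 t => t ∈ Set.Icc 1 (p.size + 1)
  | .path k => k ∈ Set.Icc 1 p.size
  | .fluent _ => True
  | .literal _ => True
  | .contrary l l' => l' = l.compl
  | .isSensed g => g ∈ P.D.sensed
  | .action _ => True
  -- Idling continues beyond the horizon, hence the explicit upper bound; `Reach` itself gives `1 ≤
  -- t`.
  | .holds l t k => t ≤ p.size + 1 ∧ l ∈ known P p t k
  -- The rule for `poss` also fires on unused paths when the condition is empty; there `known` is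
  -- empty.
  | .poss a t k => t ∈ Set.Icc 1 p.size ∧ k ∈ Set.Icc 1 p.size ∧
      P.D.Executable a (known P p t k)
  | .occ a t k => Occurs P p a t k
  | .e l t k => ∃ a, Occurs P p a t k ∧ l ∈ P.D.e a (known P p t k)
  | .pc l t k => ∃ a, Occurs P p a t k ∧ l ∈ P.D.pc a (known P p t k)
  | .goal t k => t ∈ Set.Icc 1 (p.size + 1) ∧ k ∈ Set.Icc 1 p.size ∧
      (P.G ⊆ known P p t k ∨ ¬ Consistent (known P p t k))
  | .br g t k k' => Branches P p g t k k'
  | .used t k => t ≤ p.size + 1 ∧ ∃ δ q, Reach P p t k δ q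
  | .newBr k k' => k ∈ Set.Icc 1 p.size ∧ k ≤ k' ∧ k' ∈ Set.Icc 1 p.size

/-- The answer set that describes the execution of `p`. -/
def answerSet (P : Problem F A) (p : Plan P.D) : Set (Atom F A) := {x | InAnswerSet P p x}

theorem Occurs.unique {a b : A} {t k : ℕ} (ha : Occurs P p a t k) (hb : Occurs P p b t k) :
    a = b := by
  obtain ⟨δ, q, h, hq⟩ := ha
  obtain ⟨δ', q', h', hq'⟩ := hb
  obtain ⟨rfl, rfl⟩ := h.unique h'
  exact Option.some.inj (hq.symm.trans hq')

theorem Reach.occurs_iff {t k : ℕ} {δ : Set (Lit F)} {q : Plan P.D} (h : Reach P p t k δ q)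
    {a : A} : Occurs P p a t k ↔ q.first = some a := by
  refine ⟨?_, fun hq => ⟨δ, q, h, hq⟩⟩
  rintro ⟨δ', q', h', hq⟩
  rwa [(h.unique h').2]

theorem Occurs.sensing (hwf : P.D.WellFormed) {a : A} {θ : Set (Lit F)} {t k : ℕ}
    (h : Occurs P p a t k) (ha : (a, θ) ∈ P.D.determines) :
    ∃ δ r, Reach P p t k δ (.sense a θ ha r) := by
  obtain ⟨δ, q, h, hq⟩ := h
  obtain ⟨r, rfl⟩ := Plan.first_eq_some_sensing hwf hq ha
  exact ⟨δ, r, h⟩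

theorem Occurs.nonsensing {a : A} {t k : ℕ} (h : Occurs P p a t k) (ha : ¬ P.D.IsSensing a) :
    ∃ δ r, Reach P p t k δ (.act a ha r) := by
  obtain ⟨δ, q, h, hq⟩ := h
  obtain ⟨r, rfl⟩ := Plan.first_eq_some_nonsensing hq ha
  exact ⟨δ, r, h⟩

theorem Reach.branches {t k : ℕ} {δ : Set (Lit F)} {a : A} {θ : Set (Lit F)}
    {ha : (a, θ) ∈ P.D.determines} {q : θ → Plan P.D}
    (h : Reach P p t k δ (.sense a θ ha q)) (g : θ) :
    Branches P p g t k (k + offset (fun g => (q g).size) g) :=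
  ⟨δ, a, θ, ha, q, g.2, h, rfl⟩

theorem Reach.branches_iff {t k k' : ℕ} {δ : Set (Lit F)} {a : A} {θ : Set (Lit F)}
    {ha : (a, θ) ∈ P.D.determines} {q : θ → Plan P.D}
    (h : Reach P p t k δ (.sense a θ ha q)) (g : θ) :
    Branches P p g t k k' ↔ k' = k + offset (fun g => (q g).size) g := by
  refine ⟨?_, fun hk => hk ▸ h.branches g⟩
  rintro ⟨δ', a', θ', ha', q', hg, h', hk⟩
  have := (h.unique h').2
  cases this
  exact hk

theorem Branches.reach {g : Lit F} {t k k' : ℕ} (h : Branches P p g t k k') :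
    ∃ δ q, Reach P p (t + 1) k' (P.D.Cl (δ ∪ {g})) q ∧ known P p t k = δ := by
  obtain ⟨δ, a, θ, ha, q, hg, h, rfl⟩ := h
  exact ⟨δ, q ⟨g, hg⟩, h.step (.sense _ _ _ _ _ _ ⟨g, hg⟩), h.known_eq⟩

theorem Branches.interval {g : Lit F} {t k k' : ℕ} (h : Branches P p g t k k') :
    ∃ δ q, Reach P p t k δ q ∧ k ≤ k' ∧ k' < k + q.size := by
  obtain ⟨δ, a, θ, ha, q, hg, h, rfl⟩ := h
  have hi := (Step.sense k δ a θ ha q ⟨g, hg⟩).interval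
  have := (q ⟨g, hg⟩).size_pos
  exact ⟨δ, _, h, by omega, by omega⟩

theorem Branches.label_unique {g g' : Lit F} {t k k' : ℕ} (h : Branches P p g t k k')
    (h' : Branches P p g' t k k') : g = g' := by
  obtain ⟨δ, a, θ, ha, q, hg, h, hk⟩ := h
  obtain ⟨δ', a', θ', ha', q', hg', h', hk'⟩ := h'
  have := (h.unique h').2
  cases this
  by_contra hne
  have hd := offset_disjoint (fun g => (q g).size) (i := ⟨g, hg⟩) (j := ⟨g', hg'⟩)
    (fun h => hne (congrArg Subtype.val h))
  have h₁ := (q ⟨g, hg⟩).size_pos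
  have h₂ := (q ⟨g', hg'⟩).size_pos
  omega

/-- The target `k'` lies in the interval reserved from `k`. A path in use lies in its own interval,
so it can be a target only of itself; every other target is fresh. -/
theorem Branches.eq_of_reach {g : Lit F} {t k k' : ℕ} (h : Branches P p g t k k')
    {δ : Set (Lit F)} {q : Plan P.D} (h' : Reach P p t k' δ q) : k = k' := by
  obtain ⟨δ₁, q₁, h₁, hk⟩ := h.interval
  have := q.size_pos
  exact (h₁.unique_of_mem h' hk ⟨le_rfl, by omega⟩).1

theorem Branches.source_unique {g₁ g₂ : Lit F} {t k₁ k₂ k : ℕ} (h₁ : Branches P p g₁ t k₁ k)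
    (h₂ : Branches P p g₂ t k₂ k) : k₁ = k₂ := by
  obtain ⟨δ₁, q₁, h₁, hk₁⟩ := h₁.interval
  obtain ⟨δ₂, q₂, h₂, hk₂⟩ := h₂.interval
  exact (h₁.unique_of_mem h₂ hk₁ hk₂).1

theorem mem_known {t k : ℕ} {l : Lit F} (h : l ∈ known P p t k) :
    ∃ δ q, Reach P p t k δ q ∧ l ∈ δ := h

/-- On an unused path nothing is known, and no static law applies because bodies are non-empty. -/
theorem satStatics_known (hwf : P.D.WellFormed) (t k : ℕ) : P.D.SatStatics (known P p t k) := by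
  intro l φ hl hφ
  obtain ⟨m, hm⟩ := hwf.body_nonempty l φ hl
  obtain ⟨δ, q, h, -⟩ := mem_known (hφ hm)
  rw [h.known_eq] at hφ ⊢
  exact h.satStatics l φ hl hφ

theorem Reach.exists_stay (hwf : P.D.WellFormed) {t k : ℕ} {δ : Set (Lit F)} {a : A}
    {θ : Set (Lit F)} {ha : (a, θ) ∈ P.D.determines} {q : θ → Plan P.D}
    (h : Reach P p t k δ (.sense a θ ha q)) : ∃ g : θ, Branches P p g t k k := by
  have : Nonempty θ := (hwf.sensed_nontrivial a θ ha).nonempty.to_subtype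
  obtain ⟨g, hg⟩ := exists_offset_eq_zero (fun g => (q g).size)
  exact ⟨g, (h.branches_iff g).2 (by omega)⟩

theorem Reach.exists_step (hwf : P.D.WellFormed) {t k : ℕ} {δ : Set (Lit F)} {q : Plan P.D}
    (h : Reach P p t k δ q) : ∃ δ' q', Reach P p (t + 1) k δ' q' := by
  cases q with
  | empty => exact ⟨_, _, h.step (.idle _ _)⟩
  | act a ha q => exact ⟨_, _, h.step (.act _ _ _ _ _)⟩
  | sense a θ ha q =>
    obtain ⟨g, hg⟩ := h.exists_stay hwf
    obtain ⟨δ', q', h', -⟩ := hg.reach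
    exact ⟨_, q', h'⟩

theorem mem_known_of_effect (hwf : P.D.WellFormed) {t k : ℕ} {l : Lit F} {a : A}
    (ha : Occurs P p a t k) (hl : l ∈ P.D.e a (known P p t k)) : l ∈ known P p (t + 1) k := by
  by_cases hs : P.D.IsSensing a
  · rw [hwf.e_sensing hs] at hl
    exact hl.elim
  · obtain ⟨δ, r, h⟩ := ha.nonsensing hs
    rw [h.known_eq] at hl
    exact ⟨_, _, h.step (.act _ _ _ _ _), Domain.subset_Cl _ (Or.inl hl)⟩

/-- Idling copies `δ`, a non-sensing action keeps what is outside `¬pc`, and after sensing some case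
stays on path `k` with a closure that includes `δ`. -/
theorem mem_known_of_inertia (hwf : P.D.WellFormed) {t k : ℕ} {l : Lit F}
    (hl : l ∈ known P p t k)
    (hpc : ∀ a, Occurs P p a t k → l.compl ∉ P.D.pc a (known P p t k)) :
    l ∈ known P p (t + 1) k := by
  obtain ⟨δ, q, h, hl⟩ := hl
  cases q with
  | empty => exact ⟨_, _, h.step (.idle _ _), hl⟩
  | act a ha q =>
    refine ⟨_, _, h.step (.act _ _ _ _ _), Domain.subset_Cl _ (Or.inr ⟨hl, ?_⟩)⟩
    rintro ⟨m, hm, rfl⟩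
    have := hpc a (h.occurs_iff.2 rfl)
    rw [h.known_eq, Lit.compl_compl] at this
    exact this hm
  | sense a θ ha q =>
    obtain ⟨g, hg⟩ := h.exists_stay hwf
    obtain ⟨δ', q', h', hδ⟩ := hg.reach
    rw [h.known_eq] at hδ
    subst hδ
    exact ⟨_, _, h', Domain.subset_Cl _ (Or.inl hl)⟩

/-! ### The recorded set satisfies the program -/

theorem eSet_inter_eq_empty_iff {a : A} {t k : ℕ} (ha : Occurs P p a t k) (σ : Set (Lit F)) :
    eSet σ t k ∩ answerSet P p = ∅ ↔ σ ∩ P.D.e a (known P p t k) = ∅ := by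
  simp only [Set.eq_empty_iff_forall_notMem]
  constructor
  · rintro h l ⟨hl, he⟩
    exact h (.e l t k) ⟨⟨l, hl, rfl⟩, a, ha, he⟩
  · rintro h _ ⟨⟨l, hl, rfl⟩, b, hb, he⟩
    obtain rfl := ha.unique hb
    exact h l ⟨hl, he⟩

theorem holdsSet_inter_eq_empty_iff {t k : ℕ} (ht : t ≤ p.size + 1) (σ : Set (Lit F)) :
    holdsSet σ t k ∩ answerSet P p = ∅ ↔ σ ∩ known P p t k = ∅ := by
  simp only [Set.eq_empty_iff_forall_notMem]
  constructor
  · rintro h l ⟨hl, he⟩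
    exact h (.holds l t k) ⟨⟨l, hl, rfl⟩, ht, he⟩
  · rintro h _ ⟨⟨l, hl, rfl⟩, -, he⟩
    exact h l ⟨hl, he⟩

theorem subset_known_of_holdsSet {t k : ℕ} {σ : Set (Lit F)}
    (h : holdsSet σ t k ⊆ answerSet P p) : σ ⊆ known P p t k :=
  fun l hl => (h ⟨l, hl, rfl⟩ : InAnswerSet P p (.holds l t k)).2

/-- Rules deriving `e`, `pc` and `holds` mirror closure conditions, branching constraints follow
from disjointness of intervals, and the constraints on goals, executability and sensing follow from
`Achieves`. -/
theorem rule_sat_answerSet (hwf : P.D.WellFormed) (hp : Achieves P P.initialState p)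
    {r : Rule (Atom F A)} (hr : IsRule P p.size p.size r) : r.Sat (answerSet P p) := by
  intro hpos hneg
  have neg {x : Atom F A} (hx : x ∈ r.neg) : ¬ InAnswerSet P p x := fun hx' =>
    Set.eq_empty_iff_forall_notMem.1 hneg x ⟨hx, hx'⟩
  have pos {x : Atom F A} (hx : x ∈ r.pos) : InAnswerSet P p x := hpos hx
  cases hr with
  | time t ht => exact ht
  | time1 t ht => exact ht
  | path k hk => exact hk
  | action a => exact trivial
  | fluent f => exact trivial
  | isSensed g hg => exact hg
  | initially l hl => exact ⟨by omega, _, _, .root, Domain.subset_Cl _ hl⟩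
  | executable a ψ ha t k ht hk => exact ⟨ht, hk, ψ, ha, subset_known_of_holdsSet hpos⟩
  | causes_e a l φ ha t k ht hk =>
    exact ⟨a, pos (Or.inl rfl), Domain.subset_Cl _
      ⟨φ, ha, subset_known_of_holdsSet fun x hx => hpos (Or.inr hx)⟩⟩
  | causes_pc a l φ ha t k ht hk =>
    have h₁ : complSet φ ∩ known P p t k = ∅ := by
      rw [← holdsSet_inter_eq_empty_iff (ht.2.trans (Nat.le_succ _))]
      exact Set.subset_empty_iff.1 (hneg ▸ Set.inter_subset_inter_left _ fun x hx => Or.inr hx)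
    exact ⟨a, pos rfl, Domain.pcStep_zero_subset_pc _ _
      ⟨φ, ha, fun hl => neg (Or.inl rfl) ⟨ht.2.trans (Nat.le_succ _), hl⟩, h₁⟩⟩
  | determines_stay a θ ha t k ht hk =>
    have hocc : Occurs P p a t k := pos rfl
    obtain ⟨δ, q, h⟩ := hocc.sensing hwf ha
    obtain ⟨g, hg⟩ := h.exists_stay hwf
    exact neg ⟨g.1, g.2, rfl⟩ hg
  | determines_branch a θ ha g hg t k ht hk =>
    have hocc : Occurs P p a t k := pos rfl
    obtain ⟨δ, q, h⟩ := hocc.sensing hwf ha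
    have hb := h.branches ⟨g, hg⟩
    obtain ⟨δ', q', h', -⟩ := hb.reach
    refine ⟨.br g t k _, ⟨⟨_, h'.mem_Icc, Nat.le_add_right _ _, rfl⟩, hb⟩, ?_⟩
    rintro _ ⟨⟨x, -, -, rfl⟩, hx⟩
    rw [(h.branches_iff ⟨g, hg⟩).1 hx]
  | determines_unknown a θ ha g hg t k ht hk =>
    have hocc : Occurs P p a t k := pos (Or.inl rfl)
    obtain ⟨δ, q, h⟩ := hocc.sensing hwf ha
    have hh : InAnswerSet P p (.holds g t k) := pos (Or.inr rfl)
    have hgδ := hh.2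
    rw [h.known_eq] at hgδ
    cases h.achieves hp with
    | sense _ _ _ _ _ _ _ _ hθ => exact hθ g hg hgδ
  | static_pc l φ hl l' hl' t k ht hk =>
    obtain ⟨a, ha, hpc⟩ : InAnswerSet P p (.pc l' t k) := pos rfl
    have h₁ : complSet φ ∩ P.D.e a (known P p t k) = ∅ := by
      rw [← eSet_inter_eq_empty_iff ha]
      exact Set.subset_empty_iff.1 (hneg ▸ Set.inter_subset_inter_left _ fun x hx => Or.inr hx)
    exact ⟨a, ha, Domain.mem_pc_of_static hl
      (fun hl => neg (Or.inl rfl) ⟨ht.2.trans (Nat.le_succ _), hl⟩) hl' hpc h₁⟩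
  | static_e l φ hl t k ht hk =>
    -- A body literal supplies the occurring action; uniqueness of that action makes all body
    -- literals effects of the same one.
    obtain ⟨m, hm⟩ := hwf.body_nonempty l φ hl
    obtain ⟨a, ha, -⟩ : InAnswerSet P p (.e m t k) := pos ⟨m, hm, rfl⟩
    refine ⟨a, ha, Domain.satStatics_Cl _ l φ hl fun m hm => ?_⟩
    obtain ⟨b, hb, he⟩ : InAnswerSet P p (.e m t k) := pos ⟨m, hm, rfl⟩
    obtain rfl := ha.unique hb
    exact he
  | static_holds l φ hl t k ht hk =>
    exact ⟨ht.2, satStatics_known hwf t k l φ hl (subset_known_of_holdsSet hpos)⟩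
  | goal t k ht hk => exact ⟨ht, hk, Or.inl (subset_known_of_holdsSet hpos)⟩
  | goal_inconsistent l l' t k ht hk =>
    have hc : l' = l.compl := (pos (Or.inl rfl) : InAnswerSet P p (.contrary l l'))
    have h₁ : InAnswerSet P p (.holds l t k) := pos (Or.inr (Or.inl rfl))
    have h₂ : InAnswerSet P p (.holds l' t k) := pos (Or.inr (Or.inr rfl))
    subst hc
    exact ⟨ht, hk, Or.inr fun h => h l h₁.2 h₂.2⟩
  | goal_reached k hk =>
    obtain ⟨-, δ, q, h⟩ : InAnswerSet P p (.used (p.size + 1) k) := pos rfl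
    refine neg rfl ⟨⟨h.one_le_time, le_rfl⟩, hk, ?_⟩
    rw [h.known_eq]
    -- At time `p.size + 1` a non-empty subplan would violate the time bound, so only a leaf
    -- remains.
    cases h.achieves hp with
    | empty _ hG => exact hG
    | act =>
      have := h.time_mem_Icc (by simp)
      simp at this
    | sense =>
      have := h.time_mem_Icc (by simp)
      simp at this
  | effect l t k ht hk =>
    obtain ⟨a, ha, hl⟩ : InAnswerSet P p (.e l t k) := pos rfl
    exact ⟨Nat.succ_le_succ ht.2, mem_known_of_effect hwf ha hl⟩
  | inertia l l' t k ht hk =>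
    have h₁ : InAnswerSet P p (.holds l t k) := pos (Or.inl rfl)
    have hc : l' = l.compl := (pos (Or.inr rfl) : InAnswerSet P p (.contrary l l'))
    subst hc
    exact ⟨Nat.succ_le_succ ht.2, mem_known_of_inertia hwf h₁.2 fun a ha hpc =>
      neg rfl ⟨a, ha, hpc⟩⟩
  | branch_source g₁ g₂ hg₁ hg₂ t k₁ k₂ k ht hk₁ hk₂ hk h₁₂ h₂ =>
    have h₁ : Branches P p g₁ t k₁ k := pos (Or.inl rfl)
    have h₂ : Branches P p g₂ t k₂ k := pos (Or.inr rfl)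
    exact h₁₂.ne (h₁.source_unique h₂)
  | branch_label g₁ g₂ hg₁ hg₂ t k₁ k ht hk₁ hk h₁ hne =>
    have h₁ : Branches P p g₁ t k₁ k := pos (Or.inl rfl)
    have h₂ : Branches P p g₂ t k₁ k := pos (Or.inr rfl)
    exact hne (h₁.label_unique h₂)
  | branch_fresh g hg t k₁ k ht hk₁ hk hlt =>
    have h₁ : Branches P p g t k₁ k := pos (Or.inl rfl)
    obtain ⟨-, δ, q, h⟩ : InAnswerSet P p (.used t k) := pos (Or.inr rfl)
    exact hlt.ne (h₁.eq_of_reach h)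
  | branch_used g hg t k₁ k ht hk₁ hk hlt =>
    have h₁ : Branches P p g t k₁ k := pos rfl
    obtain ⟨δ, q, h, -⟩ := h₁.reach
    exact ⟨Nat.succ_le_succ ht.2, _, q, h⟩
  | branch_sensed g hg t k₁ k ht hk₁ hk hle =>
    have h₁ : Branches P p g t k₁ k := pos rfl
    obtain ⟨δ, q, h, -⟩ := h₁.reach
    exact ⟨Nat.succ_le_succ ht.2, _, q, h, Domain.subset_Cl _ (Or.inr rfl)⟩
  | branch_inherit g hg l t k₁ k ht hk₁ hk hlt =>
    have h₁ : Branches P p g t k₁ k := pos (Or.inl rfl)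
    have h₂ : InAnswerSet P p (.holds l t k₁) := pos (Or.inr rfl)
    obtain ⟨δ, q, h, hδ⟩ := h₁.reach
    exact ⟨Nat.succ_le_succ ht.2, _, q, h, Domain.subset_Cl _ (Or.inl (hδ ▸ h₂.2))⟩
  | occ_choice t k ht hk =>
    obtain ⟨-, δ, q, h⟩ : InAnswerSet P p (.used t k) := pos rfl
    -- A finished subplan sits at a leaf of `Achieves`, where `goal` holds and blocks the choice
    -- rule.
    have hne : q ≠ .empty := by
      rintro rfl
      cases h.achieves hp with
      | empty _ hG => exact neg rfl ⟨⟨ht.1, ht.2.trans (Nat.le_succ _)⟩, hk, h.known_eq ▸ hG⟩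
    obtain ⟨a, ha⟩ := Plan.exists_first hne
    refine ⟨.occ a t k, ⟨⟨a, rfl⟩, δ, q, h, ha⟩, ?_⟩
    rintro _ ⟨⟨b, rfl⟩, hb⟩
    have hb : Occurs P p b t k := hb
    rw [hb.unique ⟨δ, q, h, ha⟩]
  | occ_poss a t k ht hk =>
    obtain ⟨δ, q, h, ha⟩ : Occurs P p a t k := pos rfl
    exact neg rfl ⟨ht, hk, h.known_eq ▸ (h.achieves hp).executable ha⟩
  | literal_pos f => exact trivial
  | literal_neg f => exact trivial
  | contrary_pos f => exact rfl
  | contrary_neg f => exact rfl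
  | newBr k k₁ hk hk₁ hle => exact ⟨hk, hle, hk₁⟩
  | used_root => exact ⟨by omega, _, _, .root⟩
  | used_next t k ht hk =>
    obtain ⟨-, δ, q, h⟩ : InAnswerSet P p (.used t k) := pos rfl
    exact ⟨Nat.succ_le_succ ht.2, h.exists_step hwf⟩

/-! ## The answer set is the least model of its reduct -/

/-- `T` is a model of the reduct of the encoding relative to the answer set for `p`. -/
def IsReductModel (P : Problem F A) (p : Plan P.D) (T : Set (Atom F A)) : Prop :=
  ∀ d ∈ glReduct (program P p.size p.size) (answerSet P p), d.2 ⊆ T → d.1 ∈ T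

namespace IsReductModel

theorem atom_mem (hT : IsReductModel P p T) {x : Atom F A} {pos neg : Set (Atom F A)}
    (hr : IsRule P p.size p.size ⟨.atom x, pos, neg⟩) (hneg : neg ∩ answerSet P p = ∅)
    (hpos : pos ⊆ T) : x ∈ T :=
  hT (x, pos) ⟨_, hr, hneg, rfl, rfl⟩ hpos

theorem atom_mem_of_definite (hT : IsReductModel P p T) {x : Atom F A} {pos : Set (Atom F A)}
    (hr : IsRule P p.size p.size ⟨.atom x, pos, ∅⟩) (hpos : pos ⊆ T) : x ∈ T :=
  hT.atom_mem hr (Set.empty_inter _) hpos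

theorem fact_mem (hT : IsReductModel P p T) {x : Atom F A}
    (hr : IsRule P p.size p.size ⟨.atom x, ∅, ∅⟩) : x ∈ T :=
  hT.atom_mem_of_definite hr (Set.empty_subset _)

theorem contrary_mem (hT : IsReductModel P p T) (l : Lit F) : .contrary l l.compl ∈ T := by
  cases l with
  | pos f => exact hT.fact_mem (.contrary_pos f)
  | neg f => exact hT.fact_mem (.contrary_neg f)

variable {t k : ℕ}

/-- The literals `l` with `holds(l, t, k)` in `T` satisfy the static laws, so minimality of the
closure applies. -/
theorem holds_mem_of_mem_Cl (hT : IsReductModel P p T) (ht : t ∈ Set.Icc 1 (p.size + 1))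
    (hk : k ∈ Set.Icc 1 p.size) {σ : Set (Lit F)} (hσ : ∀ l ∈ σ, .holds l t k ∈ T) {l : Lit F}
    (hl : l ∈ P.D.Cl σ) : .holds l t k ∈ T := by
  refine Domain.Cl_subset (τ := {l | Atom.holds l t k ∈ T})
    (fun l hl => hσ l hl) (fun l φ hlφ hφ => ?_) hl
  refine hT.atom_mem_of_definite (.static_holds l φ hlφ t k ht hk) ?_
  rintro _ ⟨m, hm, rfl⟩
  exact hφ hm

theorem e_mem (hT : IsReductModel P p T) (ht : t ∈ Set.Icc 1 p.size)
    (hk : k ∈ Set.Icc 1 p.size) {a : A} {δ : Set (Lit F)} (hocc : .occ a t k ∈ T)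
    (hδ : ∀ l ∈ δ, .holds l t k ∈ T) {l : Lit F} (hl : l ∈ P.D.e a δ) : .e l t k ∈ T := by
  refine Domain.Cl_subset (τ := {l | Atom.e l t k ∈ T}) ?_ (fun l φ hlφ hφ => ?_) hl
  · rintro l ⟨φ, hφ, hφδ⟩
    refine hT.atom_mem_of_definite (.causes_e a l φ hφ t k ht hk) ?_
    rintro _ (rfl | ⟨m, hm, rfl⟩)
    · exact hocc
    · exact hδ m (hφδ hm)
  · refine hT.atom_mem_of_definite (.static_e l φ hlφ t k ht hk) ?_
    rintro _ ⟨m, hm, rfl⟩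
    exact hφ hm

/-- Negated atoms are evaluated in the fixed answer set and not in `T`, so the conditions defining
`pcStep` translate exactly and induction on the stage works. -/
theorem pc_mem (hT : IsReductModel P p T) (ht : t ∈ Set.Icc 1 p.size)
    (hk : k ∈ Set.Icc 1 p.size) {a : A} (ha : Occurs P p a t k) (hocc : .occ a t k ∈ T)
    {l : Lit F} (hl : l ∈ P.D.pc a (known P p t k)) : .pc l t k ∈ T := by
  have ht' : t ≤ p.size + 1 := ht.2.trans (Nat.le_succ _)
  have neg {l : Lit F} {N : Set (Atom F A)} (hl : l ∉ known P p t k)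
      (hN : N ∩ answerSet P p = ∅) : ({.holds l t k} ∪ N) ∩ answerSet P p = ∅ := by
    rw [Set.union_inter_distrib_right, hN, Set.union_empty, Set.eq_empty_iff_forall_notMem]
    rintro _ ⟨rfl, hx⟩
    exact hl hx.2
  obtain ⟨i, hi⟩ := Set.mem_iUnion.1 hl
  induction i generalizing l with
  | zero =>
    obtain ⟨φ, hφ, hl, hn⟩ := hi
    exact hT.atom_mem (.causes_pc a l φ hφ t k ht hk)
      (neg hl ((holdsSet_inter_eq_empty_iff ht' _).2 hn)) (Set.singleton_subset_iff.2 hocc)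
  | succ i ih =>
    rcases hi with hi | ⟨φ, hφ, hl, ⟨l', hl', hpc⟩, hn⟩
    · exact ih hl hi
    · exact hT.atom_mem (.static_pc l φ hφ l' hl' t k ht hk)
        (neg hl ((eSet_inter_eq_empty_iff ha _).2 hn))
        (Set.singleton_subset_iff.2 (ih (Set.mem_iUnion.2 ⟨i, hpc⟩) hpc))

theorem holds_mem_of_inertia (hT : IsReductModel P p T) (ht : t ∈ Set.Icc 1 p.size)
    (hk : k ∈ Set.Icc 1 p.size) {l : Lit F} (hl : .holds l t k ∈ T)
    (hpc : ∀ a, Occurs P p a t k → l.compl ∉ P.D.pc a (known P p t k)) :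
    .holds l (t + 1) k ∈ T := by
  refine hT.atom_mem (.inertia l l.compl t k ht hk) ?_ ?_
  · rw [Set.eq_empty_iff_forall_notMem]
    rintro _ ⟨rfl, a, ha, h⟩
    exact hpc a ha h
  · rintro _ (rfl | rfl)
    · exact hl
    · exact hT.contrary_mem l

/-- The choice rule supports `occ(a, t, k)` because that atom is in the candidate. The rule survives
in the reduct because at a non-empty subplan the goal fails and the known literals are consistent.
-/
theorem occ_mem (hT : IsReductModel P p T) (hp : Achieves P P.initialState p)
    {δ : Set (Lit F)} {q : Plan P.D} (h : Reach P p t k δ q) (hu : .used t k ∈ T) {a : A}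
    (ha : q.first = some a) : .occ a t k ∈ T := by
  have hq : q ≠ .empty := by
    rintro rfl
    simp [Plan.first] at ha
  refine hT (_, {.used t k}) ⟨_, .occ_choice t k (h.time_mem_Icc hq) h.mem_Icc, ?_,
    ⟨⟨a, rfl⟩, δ, q, h, ha⟩, rfl⟩ (Set.singleton_subset_iff.2 hu)
  rw [Set.eq_empty_iff_forall_notMem]
  rintro _ ⟨rfl, -, -, hG⟩
  rw [h.known_eq] at hG
  have := (h.achieves hp).of_ne_empty hq
  tauto

theorem br_mem (hT : IsReductModel P p T) {a : A} {θ : Set (Lit F)}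
    (ha : (a, θ) ∈ P.D.determines) (hocc : .occ a t k ∈ T) {g : Lit F} (hg : g ∈ θ) {k' : ℕ}
    (ht : t ∈ Set.Icc 1 p.size) (h : Branches P p g t k k') : .br g t k k' ∈ T := by
  obtain ⟨δ', q', h', -⟩ := h.reach
  obtain ⟨δ, q, h₁, hk, -⟩ := h.interval
  exact hT (_, {.occ a t k}) ⟨_, .determines_branch a θ ha g hg t k ht h₁.mem_Icc,
    Set.empty_inter _, ⟨⟨k', h'.mem_Icc, hk, rfl⟩, h⟩, rfl⟩ (Set.singleton_subset_iff.2 hocc)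

/-- This is the core of minimality. Both claims are carried along the execution together: `used`
triggers the action, and the action with the current literals yields the next ones. -/
theorem used_and_holds_mem (hT : IsReductModel P p T) (hwf : P.D.WellFormed)
    (hp : Achieves P P.initialState p) {δ : Set (Lit F)} {q : Plan P.D}
    (h : Reach P p t k δ q) (ht : t ≤ p.size + 1) :
    .used t k ∈ T ∧ ∀ l ∈ δ, .holds l t k ∈ T := by
  induction h with
  | root =>
    refine ⟨hT.fact_mem .used_root, fun l hl => ?_⟩
    exact hT.holds_mem_of_mem_Cl ⟨le_rfl, ht⟩ Reach.root.mem_Icc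
      (fun l hl => hT.fact_mem (.initially l hl)) hl
  | @step t k k' δ δ' q q' h hs ih =>
    obtain ⟨hu, hδ⟩ := ih (by omega)
    have ht₁ : t ∈ Set.Icc 1 p.size := ⟨h.one_le_time, by omega⟩
    have ht₂ : t + 1 ∈ Set.Icc 1 (p.size + 1) := ⟨by omega, ht⟩
    have hk := h.mem_Icc
    have hk' := (h.step hs).mem_Icc
    have hu' : .used (t + 1) k ∈ T :=
      hT.atom_mem_of_definite (.used_next t k ht₁ hk) (Set.singleton_subset_iff.2 hu)
    cases hs with
    | idle =>
      refine ⟨hu', fun l hl => hT.holds_mem_of_inertia ht₁ hk (hδ l hl) fun a ha => ?_⟩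
      have := h.occurs_iff.1 ha
      simp [Plan.first] at this
    | act a ha =>
      have hocc := hT.occ_mem hp h hu rfl
      refine ⟨hu', fun l hl => hT.holds_mem_of_mem_Cl ht₂ hk ?_ hl⟩
      rintro l (hl | ⟨hl, hpc⟩)
      · exact hT.atom_mem_of_definite (.effect l t k ht₁ hk)
          (Set.singleton_subset_iff.2 (hT.e_mem ht₁ hk hocc hδ hl))
      · refine hT.holds_mem_of_inertia ht₁ hk (hδ l hl) fun b hb h' => hpc ?_
        obtain rfl := Option.some.inj (h.occurs_iff.1 hb)
        rw [h.known_eq] at h'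
        exact ⟨_, h', Lit.compl_compl l⟩
    | sense a θ ha q g =>
      have hocc := hT.occ_mem hp h hu rfl
      have hs : g.1 ∈ P.D.sensed := ⟨a, θ, ha, g.2⟩
      have hb := h.branches g
      have hbr := hT.br_mem ha hocc g.2 ht₁ hb
      have hle := Nat.le_add_right k (offset (fun g => (q g).size) g)
      -- With the target as a variable, the case where it equals `k` can be substituted.
      generalize k + offset (fun g => (q g).size) g = k' at *
      refine ⟨?_, fun l hl => hT.holds_mem_of_mem_Cl ht₂ hk' ?_ hl⟩
      · rcases hle.eq_or_lt with rfl | hlt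
        · exact hu'
        · exact hT.atom_mem_of_definite (.branch_used g.1 hs t k k' ht₁ hk hk' hlt)
            (Set.singleton_subset_iff.2 hbr)
      · rintro l (hl | rfl)
        -- The inheritance rule requires a new path. On the old path the known literals survive by
        -- inertia, as sensing has empty `pc`.
        · rcases hle.eq_or_lt with rfl | hlt
          · refine hT.holds_mem_of_inertia ht₁ hk (hδ l hl) fun b hb => ?_
            obtain rfl := Option.some.inj (h.occurs_iff.1 hb)
            rw [hwf.pc_sensing ⟨θ, ha⟩]
            exact Set.notMem_empty _
          · refine hT.atom_mem_of_definite (.branch_inherit g.1 hs l t k k' ht₁ hk hk' hlt) ?_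
            rintro _ (rfl | rfl)
            · exact hbr
            · exact hδ l hl
        · exact hT.atom_mem_of_definite (.branch_sensed g.1 hs t k k' ht₁ hk hk' hle)
            (Set.singleton_subset_iff.2 hbr)

theorem occurs_mem (hT : IsReductModel P p T) (hwf : P.D.WellFormed)
    (hp : Achieves P P.initialState p) {a : A} (ha : Occurs P p a t k) :
    t ∈ Set.Icc 1 p.size ∧ k ∈ Set.Icc 1 p.size ∧ .occ a t k ∈ T := by
  obtain ⟨δ, q, h, ha⟩ := ha
  have hq : q ≠ .empty := by
    rintro rfl
    simp [Plan.first] at ha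
  have ht := h.time_mem_Icc hq
  exact ⟨ht, h.mem_Icc,
    hT.occ_mem hp h (hT.used_and_holds_mem hwf hp h (ht.2.trans (Nat.le_succ _))).1 ha⟩

theorem holds_mem (hT : IsReductModel P p T) (hwf : P.D.WellFormed)
    (hp : Achieves P P.initialState p) {l : Lit F} (ht : t ≤ p.size + 1)
    (hl : l ∈ known P p t k) : .holds l t k ∈ T := by
  obtain ⟨δ, q, h, hl⟩ := hl
  exact (hT.used_and_holds_mem hwf hp h ht).2 l hl

theorem answerSet_subset (hT : IsReductModel P p T) (hwf : P.D.WellFormed)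
    (hp : Achieves P P.initialState p) : answerSet P p ⊆ T := by
  intro x hx
  replace hx : InAnswerSet P p x := hx
  cases x with
  | time t => exact hT.fact_mem (.time t hx)
  | time1 t => exact hT.fact_mem (.time1 t hx)
  | path k => exact hT.fact_mem (.path k hx)
  | fluent f => exact hT.fact_mem (.fluent f)
  | literal l =>
    cases l with
    | pos f => exact hT.fact_mem (.literal_pos f)
    | neg f => exact hT.fact_mem (.literal_neg f)
  | contrary l l' =>
    obtain rfl : l' = l.compl := hx
    exact hT.contrary_mem l
  | isSensed g => exact hT.fact_mem (.isSensed g hx)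
  | action a => exact hT.fact_mem (.action a)
  | holds l t k => exact hT.holds_mem hwf hp hx.1 hx.2
  | poss a t k =>
    obtain ⟨ht, hk, ψ, ha, hψ⟩ := hx
    refine hT.atom_mem_of_definite (.executable a ψ ha t k ht hk) ?_
    rintro _ ⟨l, hl, rfl⟩
    exact hT.holds_mem hwf hp (ht.2.trans (Nat.le_succ _)) (hψ hl)
  | occ a t k => exact (hT.occurs_mem hwf hp hx).2.2
  | e l t k =>
    obtain ⟨a, ha, hl⟩ := hx
    obtain ⟨ht, hk, hocc⟩ := hT.occurs_mem hwf hp ha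
    exact hT.e_mem ht hk hocc
      (fun l hl => hT.holds_mem hwf hp (ht.2.trans (Nat.le_succ _)) hl) hl
  | pc l t k =>
    obtain ⟨a, ha, hl⟩ := hx
    obtain ⟨ht, hk, hocc⟩ := hT.occurs_mem hwf hp ha
    exact hT.pc_mem ht hk ha hocc hl
  | goal t k =>
    obtain ⟨ht, hk, hG | hc⟩ := hx
    · refine hT.atom_mem_of_definite (.goal t k ht hk) ?_
      rintro _ ⟨l, hl, rfl⟩
      exact hT.holds_mem hwf hp ht.2 (hG hl)
    · simp only [Consistent, not_forall, not_not] at hc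
      obtain ⟨l, hl, hl'⟩ := hc
      refine hT.atom_mem_of_definite (.goal_inconsistent l l.compl t k ht hk) ?_
      rintro _ (rfl | rfl | rfl)
      · exact hT.contrary_mem l
      · exact hT.holds_mem hwf hp ht.2 hl
      · exact hT.holds_mem hwf hp ht.2 hl'
  | br g t k k' =>
    have hb : Branches P p g t k k' := hx
    obtain ⟨δ, a, θ, ha, q, hg, h, -⟩ := hx
    obtain ⟨ht, -, hocc⟩ := hT.occurs_mem hwf hp (h.occurs_iff.2 rfl)
    exact hT.br_mem ha hocc hg ht hb
  | used t k =>
    obtain ⟨ht, δ, q, h⟩ := hx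
    exact (hT.used_and_holds_mem hwf hp h ht).1
  | newBr k k' => exact hT.fact_mem (.newBr k k' hx.1 hx.2.2 hx.2.1)

end IsReductModel

theorem isAnswerSet_answerSet (hwf : P.D.WellFormed) (hp : Achieves P P.initialState p) :
    IsAnswerSet (program P p.size p.size) (answerSet P p) := by
  have hsat : ∀ r ∈ program P p.size p.size, r.Sat (answerSet P p) :=
    fun r hr => rule_sat_answerSet hwf hp hr
  refine ⟨hsat, subset_antisymm (fun x hx => ?_) (leastModel_glReduct_subset hsat)⟩
  exact mem_leastModel.2 fun T hT => IsReductModel.answerSet_subset hT hwf hp hx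

/-! ## Extraction of the plan -/

/-- Time and path determine the subplan, its action and the target of each case, so the extraction
has exactly one value, by induction on the subplan. -/
theorem Reach.extracts_iff (hwf : P.D.WellFormed) {i k : ℕ} {δ : Set (Lit F)} {q : Plan P.D}
    (h : Reach P p i k δ q) (r : Plan P.D) :
    Extracts P.D p.size (answerSet P p) i k r ↔ r = q := by
  induction q generalizing i k δ r with
  | empty =>
    have hn (a : A) : Atom.occ a i k ∉ answerSet P p := fun ha => by
      have := h.occurs_iff.1 ha
      simp [Plan.first] at this
    constructor
    · intro hr
      cases hr with
      | empty => rfl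
      | act _ _ _ a _ hocc => exact (hn a hocc).elim
      | sense _ _ _ a _ _ hocc => exact (hn a hocc).elim
    · rintro rfl
      exact .empty _ _ (Or.inr hn)
  | act a ha q ih =>
    have hocc : Occurs P p a i k := h.occurs_iff.2 rfl
    have hi := (h.time_mem_Icc (by simp)).2
    have hs := h.step (.act _ _ _ _ _)
    constructor
    · intro hr
      cases hr with
      -- An action is still due, so `i ≤ p.size`; neither the horizon nor a missing occurrence can
      -- end the extraction here.
      | empty _ _ hor => exact (hor.resolve_left (by omega) a hocc).elim
      | act _ _ _ b hb hocc' r hr =>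
        obtain rfl := hocc.unique hocc'
        rw [(ih hs r).1 hr]
      | sense _ _ _ b θ hb hocc' =>
        obtain rfl := hocc.unique hocc'
        exact (ha ⟨θ, hb⟩).elim
    · rintro rfl
      exact .act _ _ hi a ha hocc q ((ih hs q).2 rfl)
  | sense a θ ha q ih =>
    have hocc : Occurs P p a i k := h.occurs_iff.2 rfl
    have hi := (h.time_mem_Icc (by simp)).2
    have hs (g : θ) := h.step (.sense _ _ _ _ _ _ g)
    constructor
    · intro hr
      cases hr with
      | empty _ _ hor => exact (hor.resolve_left (by omega) a hocc).elim
      | act _ _ _ b hb hocc' =>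
        obtain rfl := hocc.unique hocc'
        exact (hb ⟨θ, ha⟩).elim
      | sense _ _ _ b θ' hb hocc' κ hκ r hr =>
        obtain rfl := hocc.unique hocc'
        obtain rfl := hwf.determines_unique _ _ _ ha hb
        congr 1
        funext g
        have hg := hr g
        rw [(h.branches_iff g).1 (hκ g)] at hg
        exact (ih g (hs g) (r g)).1 hg
    · rintro rfl
      exact .sense _ _ hi a θ ha hocc _ (fun g => h.branches g) q
        fun g => (ih g (hs g) (q g)).2 rfl

end Execution

end ASCP

theorem theorem3p2 {F A : Type*} [Finite F] [Finite A] (P : ASCP.Problem F A)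
    (hwf : P.D.WellFormed) (hG : P.G.Nonempty) (hcons : P.IsConsistent)
    (p : ASCP.Plan P.D) (hp : P.IsSolution p) :
    ∃ h w : ℕ, 1 ≤ h ∧ 1 ≤ w ∧ ∃ S : Set (ASCP.Atom F A),
      ASCP.IsAnswerSet (ASCP.program P h w) S ∧
      ∀ q : ASCP.Plan P.D,
        ASCP.Extracts P.D h S 1 1 q ↔ q = P.reduct p P.initialState := by
  have hA := ASCP.achieves_reduct p hcons.2.1 hp
  have hpos := (P.reduct p P.initialState).size_pos
  -- Both parameters are the size of the reduced plan, which bounds the last time of an action and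
  -- the number of paths.
  exact ⟨_, _, hpos, hpos, _, ASCP.isAnswerSet_answerSet hwf hA,
    fun q => ASCP.Reach.root.extracts_iff hwf q⟩
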